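/- Let $(\overline M,J,\overline g)$ be a locally conformal Kähler manifold with Levi-Civita connection $\overline\nabla$: an almost Hermitian manifold in which every point has an open neighbourhood $U$ with a smooth function $f_U$ such that $e^{-f_U}\overline g|_U$ is Kähler, the forms $df_U$ gluing to a global closed $1$-form $\omega$, the Lee form. Let $B$ be the Lee vector field, $\overline g(X,B)=\omega(X)$. Let $M$ be an (immersed) CR-submanifold of $\overline M$ with induced metric $g$ and second fundamental form $h$: there is a smooth distribution $D\subset TM$ of constant rank with $JD=D$ such that its orthogonal complement $D^\perp$ in $TM$ satisfies $JD^\perp\subset TM^\perp$, where $TM^\perp$ is the normal bundle. Let $\mu$ be the orthogonal complement of $JD^\perp$ in $TM^\perp$, and let $\mathfrak F^\perp$ be the totally real foliation of $M$, i.e. the foliation with tangent distribution $D^\perp$. The metric $g$ is called bundle-like for $\mathfrak F^\perp$ if the metric that $g$ induces on the transversal distribution $D$ is parallel with respect to the intrinsic connection $(X,Y)\mapsto Q^\perp\nabla_{Q^\perp X}Y+Q^\perp[QX,Y]$ ($X\in\Gamma(TM)$, $Y\in\Gamma(D)$) on $D$; here $\nabla$ is the Levi-Civita connection of $g$, and $Q$,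 $Q^\perp$ are the orthogonal projections of $TM$ onto $D^\perp$ and onto $D$. (i) If $B|_M\in\Gamma(D)\oplus\Gamma(TM^\perp)$, then $g$ is bundle-like for $\mathfrak F^\perp$ if and only if $h(U,JV)+h(V,JU)\in\Gamma(\mu)$ for all $U,V\in\Gamma(D)$. (ii) If $D\neq 0$ (that is, $M$ is not totally real) and the $D^\perp$-component of $B$ is different from zero at some point of $M$, then $g$ is not bundle-like for $\mathfrak F^\perp$. -/

import Mathlib

open Set Filter Topology Bundle
open scoped Manifold ContDiff

noncomputable section

namespace LCK

/-! ### Linear algebra of a scalar product -/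

section LinearAlgebra

variable {V : Type*} [AddCommGroup V] [Module ℝ V] [TopologicalSpace V]

/-- The orthogonal complement of `S` with respect to the symmetric form `G`. -/
def perp (G : V →L[ℝ] V →L[ℝ] ℝ) (S : Submodule ℝ V) : Submodule ℝ V where
  carrier := {v | ∀ s ∈ S, G v s = 0}
  zero_mem' := by intro s _; simp
  add_mem' := by
    intro a b ha hb s hs
    simp [ha s hs, hb s hs]
  smul_mem' := by
    intro c a ha s hs
    simp [ha s hs]

/-- The orthogonal projection of `v` onto `S` with respect to the scalar product `G`:
the unique `t ∈ S` such that `v - t` is orthogonal to `S`. -/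
def proj (G : V →L[ℝ] V →L[ℝ] ℝ) (S : Submodule ℝ V) (v : V) : V :=
  Classical.epsilon fun t => t ∈ S ∧ v - t ∈ perp G S

/-- The vector representing the functional `l` with respect to the scalar product `G`:
the unique `w` such that `G w c = l c` for all `c`. -/
def riesz (G : V →L[ℝ] V →L[ℝ] ℝ) (l : V → ℝ) : V :=
  Classical.epsilon fun w => ∀ c, G w c = l c

/-- `proj` is the orthogonal projection, for every positive definite form. -/
theorem proj_spec [FiniteDimensional ℝ V] (G : V →L[ℝ] V →L[ℝ] ℝ)
    (hpos : ∀ v, v ≠ 0 → 0 < G v v) (S : Submodule ℝ V) (v : V) :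
    proj G S v ∈ S ∧ v - proj G S v ∈ perp G S := by
  apply Classical.epsilon_spec (p := fun t => t ∈ S ∧ v - t ∈ perp G S)
  let B : S →ₗ[ℝ] Module.Dual ℝ S :=
    { toFun := fun t => ((G t : V →L[ℝ] ℝ) : V →ₗ[ℝ] ℝ).comp S.subtype
      map_add' := by intro a b; ext c; simp
      map_smul' := by intro a b; ext c; simp }
  have hB : Function.Injective B := by
    rw [← LinearMap.ker_eq_bot, LinearMap.ker_eq_bot']
    intro t ht
    by_contra hne
    have h0 : G t t = 0 := LinearMap.congr_fun ht t
    have := hpos t (by simpa using hne)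
    linarith
  have hs : Function.Surjective B :=
    (LinearMap.injective_iff_surjective_of_finrank_eq_finrank
      (Subspace.dual_finrank_eq (K := ℝ) (V := S)).symm).1 hB
  obtain ⟨t, ht⟩ := hs (((G v : V →L[ℝ] ℝ) : V →ₗ[ℝ] ℝ).comp S.subtype)
  refine ⟨t, t.2, ?_⟩
  intro s hsS
  have : G t s = G v s := LinearMap.congr_fun ht ⟨s, hsS⟩
  simp [this]

/-- `riesz` represents every linear functional, for every positive definite form. -/
theorem riesz_spec [FiniteDimensional ℝ V] (G : V →L[ℝ] V →L[ℝ] ℝ)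
    (hpos : ∀ v, v ≠ 0 → 0 < G v v) (l : V →ₗ[ℝ] ℝ) (c : V) :
    G (riesz G l) c = l c := by
  revert c
  apply Classical.epsilon_spec (p := fun w => ∀ c, G w c = l c)
  let B : V →ₗ[ℝ] Module.Dual ℝ V :=
    { toFun := fun t => ((G t : V →L[ℝ] ℝ) : V →ₗ[ℝ] ℝ)
      map_add' := by intro a b; ext c; simp
      map_smul' := by intro a b; ext c; simp }
  have hB : Function.Injective B := by
    rw [← LinearMap.ker_eq_bot, LinearMap.ker_eq_bot']
    intro t ht
    by_contra hne
    have h0 : G t t = 0 := LinearMap.congr_fun ht t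
    have := hpos t hne
    linarith
  have hs : Function.Surjective B :=
    (LinearMap.injective_iff_surjective_of_finrank_eq_finrank
      (Subspace.dual_finrank_eq (K := ℝ) (V := V)).symm).1 hB
  obtain ⟨t, ht⟩ := hs l
  exact ⟨t, fun c => LinearMap.congr_fun ht c⟩

end LinearAlgebra

/-! ### Tensors, vector fields and the Levi-Civita connection -/

section Manifolds

variable {E : Type*} [NormedAddCommGroup E] [NormedSpace ℝ E]
  {N : Type*} [TopologicalSpace N] [ChartedSpace E N] [IsManifold 𝓘(ℝ, E) ∞ N]
  {E' : Type*} [NormedAddCommGroup E'] [NormedSpace ℝ E']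
  {M : Type*} [TopologicalSpace M] [ChartedSpace E' M] [IsManifold 𝓘(ℝ, E') ∞ M]

/-- A (not necessarily smooth) field of bilinear forms on the tangent spaces of `N`. -/
abbrev BilinField (E : Type*) [NormedAddCommGroup E] [NormedSpace ℝ E]
    (N : Type*) [TopologicalSpace N] [ChartedSpace E N] : Type _ :=
  (x : N) → TangentSpace 𝓘(ℝ, E) x →L[ℝ] TangentSpace 𝓘(ℝ, E) x →L[ℝ] ℝ

/-- A (not necessarily smooth) field of tangent vectors on `N`. -/
abbrev VField (E : Type*) [NormedAddCommGroup E] [NormedSpace ℝ E]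
    (N : Type*) [TopologicalSpace N] [ChartedSpace E N] : Type _ :=
  (x : N) → TangentSpace 𝓘(ℝ, E) x

/-- A (not necessarily smooth) field of endomorphisms of the tangent spaces of `N`. -/
abbrev EndField (E : Type*) [NormedAddCommGroup E] [NormedSpace ℝ E]
    (N : Type*) [TopologicalSpace N] [ChartedSpace E N] : Type _ :=
  (x : N) → TangentSpace 𝓘(ℝ, E) x →L[ℝ] TangentSpace 𝓘(ℝ, E) x

/-- A field of subspaces of the tangent spaces of `N`. -/
abbrev SubspaceField (E : Type*) [NormedAddCommGroup E] [NormedSpace ℝ E]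
    (N : Type*) [TopologicalSpace N] [ChartedSpace E N] : Type _ :=
  (x : N) → Submodule ℝ (TangentSpace 𝓘(ℝ, E) x)

/-- `X` is a smooth vector field on `U`. -/
def SmoothField (U : Set N) (X : VField E N) : Prop :=
  ContMDiffOn 𝓘(ℝ, E) 𝓘(ℝ, E).tangent ∞
    (fun x => (⟨x, X x⟩ : TangentBundle 𝓘(ℝ, E) N)) U

/-- `X` is a smooth section over `U` of the distribution `D`. -/
def SmoothSection (D : SubspaceField E N) (U : Set N) (X : VField E N) : Prop :=
  SmoothField U X ∧ ∀ x ∈ U, X x ∈ D x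

/-- The component function `y ↦ g(b, c)` of `g` in the chart at `p`, where `b` and `c` are
constant vectors in the chart. -/
def metricCoord (g : BilinField E N) (p : N) (b c : E) (y : E) : ℝ :=
  g ((extChartAt 𝓘(ℝ, E) p).symm y)
    (mfderiv 𝓘(ℝ, E) 𝓘(ℝ, E) (extChartAt 𝓘(ℝ, E) p).symm y b)
    (mfderiv 𝓘(ℝ, E) 𝓘(ℝ, E) (extChartAt 𝓘(ℝ, E) p).symm y c)

/-- The Christoffel symbols of `g` at `p` in the chart at `p`:
`2 g(Γ(a, b), c) = ∂_a g(b, c) + ∂_b g(a, c) - ∂_c g(a, b)`. The tangent space at `p` is identified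
with the model space through the chart at `p`. -/
def christoffel (g : BilinField E N) (p : N) (a b : TangentSpace 𝓘(ℝ, E) p) :
    TangentSpace 𝓘(ℝ, E) p :=
  riesz (g p) fun c =>
    (fderiv ℝ (metricCoord g p b c) (extChartAt 𝓘(ℝ, E) p p) a
      + fderiv ℝ (metricCoord g p a c) (extChartAt 𝓘(ℝ, E) p p) b
      - fderiv ℝ (metricCoord g p a b) (extChartAt 𝓘(ℝ, E) p p) c) / 2

/-- The tangent vector at `p` with coordinate vector `w` in the chart at `p`. -/
def ofModel (p : N) (w : E) : TangentSpace 𝓘(ℝ, E) p := w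

/-- The coordinate vectors, in the chart of `N` at `φ p`, of a vector field `W` along the map
`φ : M → N`. -/
def coordAlong (φ : M → N) (W : (q : M) → TangentSpace 𝓘(ℝ, E) (φ q)) (p : M) : M → E :=
  fun q => mfderiv 𝓘(ℝ, E) 𝓘(ℝ, E) (extChartAt 𝓘(ℝ, E) (φ p)) (φ q) (W q)

/-- The covariant derivative `∇_u W` at `p`, with respect to the Levi-Civita connection of the
metric `g` on `N`, of a vector field `W` along the map `φ : M → N`, in the direction `u ∈ T_p M`.
In the chart of `N` at `φ p` it is `∂_u W + Γ(dφ(u), W)`. -/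
def covAlong (g : BilinField E N) (φ : M → N)
    (W : (q : M) → TangentSpace 𝓘(ℝ, E) (φ q)) (p : M) (u : TangentSpace 𝓘(ℝ, E') p) :
    TangentSpace 𝓘(ℝ, E) (φ p) :=
  ofModel (φ p) (mvfderiv 𝓘(ℝ, E') (coordAlong φ W p) p u)
    + christoffel g (φ p) (mfderiv 𝓘(ℝ, E') 𝓘(ℝ, E) φ p u) (W p)

/-- The Levi-Civita covariant derivative `∇_u Y` at `p` of a vector field `Y` on `N`. -/
def leviCivita (g : BilinField E N) (Y : VField E N) (p : N) (u : TangentSpace 𝓘(ℝ, E) p) :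
    TangentSpace 𝓘(ℝ, E) p :=
  covAlong g id Y p u

/-! ### Locally conformal Kähler manifolds -/

/-- `(J, g)` is an almost Hermitian structure: `J` is a smooth almost complex structure and the
metric `g` is `J`-invariant. -/
structure IsAlmostHermitian (g : BilinField E N) (J : EndField E N) :
    Prop where
  smooth : ContMDiff 𝓘(ℝ, E) (𝓘(ℝ, E).prod 𝓘(ℝ, E →L[ℝ] E)) ∞
    (fun x => TotalSpace.mk' (E →L[ℝ] E)
      (E := fun x : N => TangentSpace 𝓘(ℝ, E) x →L[ℝ] TangentSpace 𝓘(ℝ, E) x) x (J x))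
  sq : ∀ (x : N) (v : TangentSpace 𝓘(ℝ, E) x), J x (J x v) = -v
  isometric : ∀ (x : N) (v w : TangentSpace 𝓘(ℝ, E) x), g x (J x v) (J x w) = g x v w

/-- The `J`-Hermitian metric `g` is Kähler on the open set `U`: its Levi-Civita connection
satisfies `∇ J = 0` there. -/
def IsKahlerOn (g : BilinField E N) (J : EndField E N) (U : Set N) : Prop :=
  ∀ V : Set N, IsOpen V → V ⊆ U → ∀ Y : VField E N, SmoothField V Y →
    ∀ p ∈ V, ∀ u : TangentSpace 𝓘(ℝ, E) p,
      leviCivita g (fun x => J x (Y x)) p u = J p (leviCivita g Y p u)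

/-- The conformal metric `exp (-f) g`. -/
def conformal (f : N → ℝ) (g : BilinField E N) : BilinField E N :=
  fun x => Real.exp (-f x) • g x

/-- The almost Hermitian manifold `(N, J, g)` is locally conformal Kähler with Lee form `lee`:
every point has an open neighbourhood `U` with a smooth function `f` on it such that
`exp (-f) g` is a Kähler metric on `U`, and `lee = df` on `U`. -/
structure IsLCK (g : BilinField E N) (J : EndField E N)
    (lee : (x : N) → TangentSpace 𝓘(ℝ, E) x →L[ℝ] ℝ) : Prop where
  almostHermitian : IsAlmostHermitian g J
  locally_conformal : ∀ p : N, ∃ U : Set N, IsOpen U ∧ p ∈ U ∧ ∃ f : N → ℝ,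
    ContMDiffOn 𝓘(ℝ, E) 𝓘(ℝ, ℝ) ∞ f U ∧
    IsKahlerOn (conformal f g) J U ∧
    ∀ x ∈ U, ∀ v : TangentSpace 𝓘(ℝ, E) x, lee x v = mvfderiv 𝓘(ℝ, E) f x v

/-- The Lee vector field `B = lee^♯`, i.e. `g(B, X) = lee(X)`. -/
def leeField (g : BilinField E N) (lee : (x : N) → TangentSpace 𝓘(ℝ, E) x →L[ℝ] ℝ) : VField E N :=
  fun x => riesz (g x) (lee x)

/-! ### Submanifolds -/

/-- `ι : M → N` is a smooth immersion (so that `M` is an immersed submanifold of `N`). -/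
structure IsSmoothImmersion (E' E : Type*) [NormedAddCommGroup E'] [NormedSpace ℝ E']
    [NormedAddCommGroup E] [NormedSpace ℝ E]
    {M : Type*} [TopologicalSpace M] [ChartedSpace E' M]
    {N : Type*} [TopologicalSpace N] [ChartedSpace E N] (ι : M → N) : Prop where
  smooth : ContMDiff 𝓘(ℝ, E') 𝓘(ℝ, E) ∞ ι
  injective : ∀ p : M, Function.Injective (mfderiv 𝓘(ℝ, E') 𝓘(ℝ, E) ι p)

/-- The differential of `ι` at `p`. -/
def dmap (E' E : Type*) [NormedAddCommGroup E'] [NormedSpace ℝ E']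
    [NormedAddCommGroup E] [NormedSpace ℝ E]
    {M : Type*} [TopologicalSpace M] [ChartedSpace E' M]
    {N : Type*} [TopologicalSpace N] [ChartedSpace E N] (ι : M → N) (p : M) :
    TangentSpace 𝓘(ℝ, E') p →L[ℝ] TangentSpace 𝓘(ℝ, E) (ι p) :=
  mfderiv 𝓘(ℝ, E') 𝓘(ℝ, E) ι p

/-- The metric induced by `g` on `M` through `ι : M → N`. -/
def inducedMetric (g : BilinField E N) (ι : M → N) : BilinField E' M :=
  fun p => ContinuousLinearMap.precomp ℝ (dmap E' E ι p) ∘L g (ι p) ∘L dmap E' E ι p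

/-- The normal space `T_p M^⊥ ⊆ T_{ι p} N`. -/
def normalSpace (E' : Type*) [NormedAddCommGroup E'] [NormedSpace ℝ E']
    {M : Type*} [TopologicalSpace M] [ChartedSpace E' M] (g : BilinField E N) (ι : M → N) (p : M) :
    Submodule ℝ (TangentSpace 𝓘(ℝ, E) (ι p)) :=
  perp (g (ι p)) ((dmap E' E ι p).toLinearMap.range)

/-- The second fundamental form `h(u, v)` at `p`: the normal component of `∇_u (dι Y)`, where `∇` is
the Levi-Civita connection of `g` and `Y` is the vector field extending `v` which is constant in the
chart at `p` (by the Gauss formula and the tensoriality of `h`, any extension gives the same). -/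
def secondFF (g : BilinField E N) (ι : M → N) (p : M)
    (u v : TangentSpace 𝓘(ℝ, E') p) : TangentSpace 𝓘(ℝ, E) (ι p) :=
  proj (g (ι p)) (normalSpace E' g ι p)
    (covAlong g ι
      (fun q => dmap E' E ι q
        (FiberBundle.extend E' (E := fun x : M => TangentSpace 𝓘(ℝ, E') x) v q)) p u)

/-- `D` is a smooth distribution (of constant rank) on `M`. -/
def IsSmoothDistribution (D : SubspaceField E' M) : Prop :=
  ∃ r : ℕ, ∀ p : M, ∃ U : Set M, IsOpen U ∧ p ∈ U ∧ ∃ X : Fin r → VField E' M,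
    (∀ i, SmoothField U (X i)) ∧
    ∀ q ∈ U, LinearIndependent ℝ (fun i => X i q) ∧
      Submodule.span ℝ (range fun i => X i q) = D q

/-- The orthogonal complement `D^⊥` of `D` in `TM`. -/
def orthDist (g : BilinField E' M) (D : SubspaceField E' M) : SubspaceField E' M :=
  fun p => perp (g p) (D p)

/-- The image in `T_{ι p} N` of the fibre at `p` of the distribution `D` on `M`. -/
def pushDist (E : Type*) [NormedAddCommGroup E] [NormedSpace ℝ E]
    {N : Type*} [TopologicalSpace N] [ChartedSpace E N] (ι : M → N)
    (D : SubspaceField E' M) (p : M) : Submodule ℝ (TangentSpace 𝓘(ℝ, E) (ι p)) :=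
  (D p).map (dmap E' E ι p).toLinearMap

/-- `M`, immersed by `ι` in the almost Hermitian manifold `(N, J, g)`, is a CR-submanifold with
holomorphic distribution `D` and totally real distribution `D^⊥`. -/
structure IsCRSubmanifold (g : BilinField E N) (J : EndField E N) (ι : M → N)
    (D : SubspaceField E' M) : Prop where
  immersion : IsSmoothImmersion E' E ι
  distribution : IsSmoothDistribution D
  holomorphic : ∀ p : M, (pushDist E ι D p).map (J (ι p)).toLinearMap = pushDist E ι D p
  totallyReal : ∀ p : M,
    (pushDist E ι (orthDist (inducedMetric g ι) D) p).map (J (ι p)).toLinearMap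
      ≤ normalSpace E' g ι p

/-- The subbundle `μ` of the normal bundle: the orthogonal complement of `J D^⊥` in `TM^⊥`. -/
def muSpace (g : BilinField E N) (J : EndField E N) (ι : M → N) (D : SubspaceField E' M) (p : M) :
    Submodule ℝ (TangentSpace 𝓘(ℝ, E) (ι p)) :=
  normalSpace E' g ι p ⊓
    perp (g (ι p))
      ((pushDist E ι (orthDist (inducedMetric g ι) D) p).map (J (ι p)).toLinearMap)

/-! ### Bundle-like metrics -/

/-- The intrinsic connection on the transversal distribution `F^⊥` of the foliation of `(M, g)` with
tangent distribution `F`: for `X` a vector field and `Y` a section of `F^⊥`, it is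
`Q^⊥ ∇_{Q^⊥ X} Y + Q^⊥ [Q X, Y]`, where `Q` and `Q^⊥` are the orthogonal projections of `TM` on `F`
and on `F^⊥` and `∇` is the Levi-Civita connection. -/
def intrinsicConn (g : BilinField E' M) (F : SubspaceField E' M) (X Y : VField E' M) :
    VField E' M :=
  fun p =>
    proj (g p) (orthDist g F p) (leviCivita g Y p (proj (g p) (orthDist g F p) (X p)))
    + proj (g p) (orthDist g F p)
        (VectorField.mlieBracket 𝓘(ℝ, E') (fun q => proj (g q) (F q) (X q)) Y p)

/-- The metric `g` is bundle-like for the foliation with tangent distribution `F`: the metric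
induced on the transversal distribution `F^⊥` is parallel with respect to the intrinsic
connection. -/
def IsBundleLike (g : BilinField E' M) (F : SubspaceField E' M) : Prop :=
  ∀ U : Set M, IsOpen U → ∀ X Y Z : VField E' M, SmoothField U X →
    SmoothSection (orthDist g F) U Y → SmoothSection (orthDist g F) U Z →
    ∀ p ∈ U,
      mvfderiv 𝓘(ℝ, E') (fun q => g q (Y q) (Z q)) p (X p)
        = g p (intrinsicConn g F X Y p) (Z p) + g p (Y p) (intrinsicConn g F X Z p)

end Manifolds

end LCK

end

/-!
Both parts follow from one pointwise characterization, `LCK.IsCRSubmanifold.isBundleLike_iff`: the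
induced metric is bundle-like for the totally real foliation if and only if
`g(h(u, Jv) + h(v, Ju), Jw) = g(u, v) ω(w)` for all `u, v ∈ D` and `w ∈ D^⊥`.

For sections `Y, Z` of `D` and a vector field `X` with `D^⊥`-component `W`, metric compatibility and
absence of torsion turn the condition that the intrinsic connection is metric into
`g(W, ∇_Y Z + ∇_Z Y) = 0` (`LCK.parallel_iff`). The Gauss formula (`LCK.gauss`) replaces `∇` by the
connection of the ambient space. There `J` is not parallel for the Levi-Civita connection, but it is
for the Weyl connection, the Levi-Civita connection of the local Kähler metrics
(`LCK.IsLCK.covAlong_end`). Applying `J` to `∇_Y Z` and using that `J D^⊥` is normal gives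
`g(W, ∇_Y Z) = g(JW, h(Y, JZ)) - g(Y, Z) ω(W) / 2 + g(Y, JZ) g(JW, B) / 2`
(`LCK.IsCRSubmanifold.inner_leviCivita`); the last term is skew in `Y, Z` and disappears on
symmetrizing.

If `B` has no `D^⊥`-component, then `ω` vanishes on `D^⊥` and the characterization says that
`h(u, Jv) + h(v, Ju)` is orthogonal to `J D^⊥`, which is part (i). For part (ii), the
characterization for `(u, u)` and for `(Ju, Ju)` gives `2 g(h(u, Ju), Jw) = |u|² ω(w)` and
`-2 g(h(u, Ju), Jw) = |Ju|² ω(w)` by the symmetry of `h`. Hence `ω(w) = 0` as soon as `u ≠ 0`, and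
`D` is nonzero at every point if it is at one, its rank being constant.

All computations take place at a single point `p`, in the charts at `p` and at `ι p`. The Gauss
formula needs no comparison of Christoffel symbols: covariant derivatives along `ι` and along the
identity of `M` are both metric and torsion-free, and the Koszul argument applies. Since
differentiability at `p` is all that is used, fields are only required to satisfy `LCK.DiffAlong`;
for the `D^⊥`-component of a field, and for `JZ`, it follows from Cramer's rule for the Gram matrix
of a local frame of `D` (`LCK.diffAlong_of_frame`).
-/

noncomputable section

-- The operator norms on spaces of bilinear forms make some instance problems long.
set_option synthInstance.maxHeartbeats 100000

namespace LCK

/-! ### Orthogonal projections -/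

section LinearAlgebra

variable {V : Type*} [AddCommGroup V] [Module ℝ V] [TopologicalSpace V]
  {G : V →L[ℝ] V →L[ℝ] ℝ}

theorem inner_proj [FiniteDimensional ℝ V] (hpos : ∀ v, v ≠ 0 → 0 < G v v) (S : Submodule ℝ V)
    (v : V) {s : V} (hs : s ∈ S) : G (proj G S v) s = G v s := by
  have h := (proj_spec G hpos S v).2 s hs
  have h2 : G (v - proj G S v) s = G v s - G (proj G S v) s := by
    simp
  linarith

theorem eq_zero_of_mem_perp (hpos : ∀ v, v ≠ 0 → 0 < G v v) {S : Submodule ℝ V}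
    {v : V} (h1 : v ∈ S) (h2 : v ∈ perp G S) : v = 0 := by
  by_contra h
  have := hpos v h
  rw [h2 v h1] at this
  exact lt_irrefl _ this

theorem perp_perp [FiniteDimensional ℝ V] (hpos : ∀ v, v ≠ 0 → 0 < G v v)
    (hsymm : ∀ v w, G v w = G w v) (S : Submodule ℝ V) : perp G (perp G S) = S := by
  apply le_antisymm
  · intro v hv
    obtain ⟨h1, h2⟩ := proj_spec G hpos S v
    have h3 : proj G S v ∈ perp G (perp G S) := fun s hs => by rw [hsymm]; exact hs _ h1
    have h4 := eq_zero_of_mem_perp hpos h2 (Submodule.sub_mem _ hv h3)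
    rw [sub_eq_zero.1 h4]
    exact h1
  · intro v hv s hs
    rw [hsymm]
    exact hs v hv

/-- A vector is the sum of its orthogonal projections on `perp G S` and on its orthogonal
complement. -/
theorem proj_add_proj_perp [FiniteDimensional ℝ V] (hpos : ∀ v, v ≠ 0 → 0 < G v v)
    (hsymm : ∀ v w, G v w = G w v)
    (S : Submodule ℝ V) (v : V) : proj G (perp G S) v + proj G S v = v := by
  obtain ⟨h1, h2⟩ := proj_spec G hpos S v
  obtain ⟨h3, h4⟩ := proj_spec G hpos (perp G S) v
  have h5 : v - proj G S v - proj G (perp G S) v ∈ perp G S := Submodule.sub_mem _ h2 h3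
  have h6 : v - proj G S v - proj G (perp G S) v ∈ perp G (perp G S) := by
    intro s hs
    have e1 : G (v - proj G S v - proj G (perp G S) v) s =
        G (v - proj G (perp G S) v) s - G (proj G S v) s := by
      simp only [map_sub, sub_apply]
      ring
    have e2 : G (proj G S v) s = 0 := by
      rw [hsymm]
      exact hs _ h1
    rw [e1, h4 s hs, e2, sub_zero]
  have h7 := eq_zero_of_mem_perp hpos h5 h6
  rw [sub_sub, sub_eq_zero] at h7
  rw [add_comm]
  exact h7.symm

end LinearAlgebra

/-! ### Calculus in charts -/

variable {E : Type*} [NormedAddCommGroup E] [NormedSpace ℝ E]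
  {N : Type*} [TopologicalSpace N] [ChartedSpace E N]
  {E' : Type*} [NormedAddCommGroup E'] [NormedSpace ℝ E']
  {M : Type*} [TopologicalSpace M] [ChartedSpace E' M]
  {F : Type*} [NormedAddCommGroup F] [NormedSpace ℝ F]
  {F' : Type*} [NormedAddCommGroup F'] [NormedSpace ℝ F']

instance instFiniteDimensionalTangentSpace [FiniteDimensional ℝ E] (x : N) :
    FiniteDimensional ℝ (TangentSpace 𝓘(ℝ, E) x) :=
  inferInstanceAs (FiniteDimensional ℝ E)

-- Shortcuts: the search for these two instances is expensive.
instance instNormedAddCommGroupBilin : NormedAddCommGroup (E →L[ℝ] E →L[ℝ] ℝ) :=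
  ContinuousLinearMap.toNormedAddCommGroup

instance instNormedSpaceBilin : NormedSpace ℝ (E →L[ℝ] E →L[ℝ] ℝ) :=
  ContinuousLinearMap.toNormedSpace

theorem mdifferentiableAt_iff_chart {f : M → F} {p : M} :
    MDifferentiableAt 𝓘(ℝ, E') 𝓘(ℝ, F) f p ↔ ContinuousAt f p ∧
      DifferentiableAt ℝ (f ∘ (extChartAt 𝓘(ℝ, E') p).symm) (extChartAt 𝓘(ℝ, E') p p) := by
  rw [mdifferentiableAt_iff]
  simp only [writtenInExtChartAt, Function.comp_def, extChartAt_model_space_eq_id,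
    PartialEquiv.refl_coe, id, ModelWithCorners.range_eq_univ, differentiableWithinAt_univ]

theorem mvfderiv_eq_fderiv_chart {f : M → F} {p : M}
    (hf : MDifferentiableAt 𝓘(ℝ, E') 𝓘(ℝ, F) f p) (u : TangentSpace 𝓘(ℝ, E') p) :
    mvfderiv 𝓘(ℝ, E') f p u =
      fderiv ℝ (f ∘ (extChartAt 𝓘(ℝ, E') p).symm) (extChartAt 𝓘(ℝ, E') p p) u := by
  rw [hf.mvfderiv]
  simp only [writtenInExtChartAt, Function.comp_def, extChartAt_model_space_eq_id,
    PartialEquiv.refl_coe, id, ModelWithCorners.range_eq_univ, fderivWithin_univ]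
  rfl

theorem mvfderiv_clm_apply {A : M → F →L[ℝ] F'} {v : M → F} {p : M}
    (hA : MDifferentiableAt 𝓘(ℝ, E') 𝓘(ℝ, F →L[ℝ] F') A p)
    (hv : MDifferentiableAt 𝓘(ℝ, E') 𝓘(ℝ, F) v p) (u : TangentSpace 𝓘(ℝ, E') p) :
    mvfderiv 𝓘(ℝ, E') (fun q => A q (v q)) p u =
      mvfderiv 𝓘(ℝ, E') A p u (v p) + A p (mvfderiv 𝓘(ℝ, E') v p u) := by
  rw [mvfderiv_eq_fderiv_chart (hA.clm_apply hv), mvfderiv_eq_fderiv_chart hA,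
    mvfderiv_eq_fderiv_chart hv]
  have h1 := (mdifferentiableAt_iff_chart.1 hA).2
  have h2 := (mdifferentiableAt_iff_chart.1 hv).2
  have := fderiv_clm_apply h1 h2
  have h3 := congrArg (fun L => L u) this
  simp only [Function.comp_def, extChartAt_to_inv] at h3 ⊢
  rw [add_comm]
  exact h3

theorem mvfderiv_congr {f f' : M → F} {p : M} (h : f =ᶠ[𝓝 p] f') :
    mvfderiv 𝓘(ℝ, E') f p = mvfderiv 𝓘(ℝ, E') f' p := by
  have := h.mfderiv_eq (I := 𝓘(ℝ, E')) (I' := 𝓘(ℝ, F))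
  unfold mvfderiv
  ext u
  exact congrArg (fun L : TangentSpace 𝓘(ℝ, E') p →L[ℝ] F => L u) this

theorem differentiableAt_clm_of_apply [FiniteDimensional ℝ E] {f : F' → E →L[ℝ] F} {x : F'}
    (h : ∀ v, DifferentiableAt ℝ (fun y => f y v) x) : DifferentiableAt ℝ f x := by
  let b := Module.finBasis ℝ E
  have : f = fun y => ∑ i, (LinearMap.toContinuousLinearMap (b.coord i)).smulRight (f y (b i)) := by
    ext y v
    conv_lhs => rw [← b.sum_repr v]
    simp only [map_sum, map_smul, sum_apply]
    rfl
  rw [this]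
  refine DifferentiableAt.fun_sum fun i _ => ?_
  exact ((ContinuousLinearMap.smulRightL ℝ E F
    (LinearMap.toContinuousLinearMap (b.coord i))).differentiableAt).comp x (h (b i))

theorem mfderiv_symm_extChartAt_apply [IsManifold 𝓘(ℝ, E) 1 N] {n : N} {y : E}
    (hy : y ∈ (extChartAt 𝓘(ℝ, E) n).target)
    (v : TangentSpace 𝓘(ℝ, E) ((extChartAt 𝓘(ℝ, E) n).symm y)) :
    mfderiv 𝓘(ℝ, E) 𝓘(ℝ, E) (extChartAt 𝓘(ℝ, E) n).symm y
     (mfderiv 𝓘(ℝ, E) 𝓘(ℝ, E) (extChartAt 𝓘(ℝ, E) n) ((extChartAt 𝓘(ℝ, E) n).symm y) v) = v := by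
  have := mfderivWithin_extChartAt_symm_comp_mfderiv_extChartAt hy
  rw [ModelWithCorners.range_eq_univ, mfderivWithin_univ] at this
  exact congrArg (fun L : TangentSpace 𝓘(ℝ, E) ((extChartAt 𝓘(ℝ, E) n).symm y) →L[ℝ]
    TangentSpace 𝓘(ℝ, E) ((extChartAt 𝓘(ℝ, E) n).symm y) => L v) this

theorem mfderiv_extChartAt_extend [IsManifold 𝓘(ℝ, E) 1 N] {n x : N}
    (hx : x ∈ (chartAt E n).source) (v : TangentSpace 𝓘(ℝ, E) n) :
    mfderiv 𝓘(ℝ, E) 𝓘(ℝ, E) (extChartAt 𝓘(ℝ, E) n) x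
     (FiberBundle.extend E (E := fun x : N => TangentSpace 𝓘(ℝ, E) x) v x) = v := by
  rw [← TangentBundle.continuousLinearMapAt_trivializationAt hx]
  unfold FiberBundle.extend
  have h1 : x ∈ (trivializationAt E (fun x : N => TangentSpace 𝓘(ℝ, E) x) n).baseSet := by
    simpa using hx
  rw [← Bundle.Trivialization.symmL_apply (R := ℝ) _ h1]
  erw [Bundle.Trivialization.continuousLinearMapAt_symmL _ h1]
  have h2 := TangentBundle.continuousLinearMapAt_trivializationAt (I := 𝓘(ℝ, E))
    (mem_chart_source E n)
  rw [mfderiv_extChartAt_self] at h2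
  have h3 := congrArg (fun L : E →L[ℝ] E => L v) h2
  refine Eq.trans ?_ h3
  erw [Bundle.Trivialization.continuousLinearMapAt_apply,
    Bundle.Trivialization.coe_linearMapAt_of_mem _
      (FiberBundle.mem_baseSet_trivializationAt' n)]

/-- Continuity is automatic for functions on a manifold which are differentiable in the chart. -/
theorem mdifferentiableAt_iff_differentiableAt_chart {f : N → F} {p : N} :
    MDifferentiableAt 𝓘(ℝ, E) 𝓘(ℝ, F) f p ↔
      DifferentiableAt ℝ (f ∘ (extChartAt 𝓘(ℝ, E) p).symm) (extChartAt 𝓘(ℝ, E) p p) := by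
  rw [mdifferentiableAt_iff_chart, and_iff_right_iff_imp]
  intro h
  have h1 : ContinuousAt ((f ∘ (extChartAt 𝓘(ℝ, E) p).symm) ∘ extChartAt 𝓘(ℝ, E) p) p :=
    ContinuousAt.comp h.continuousAt (continuousAt_extChartAt p)
  refine h1.congr ?_
  filter_upwards [extChartAt_source_mem_nhds (I := 𝓘(ℝ, E)) p] with x hx
  simp only [Function.comp]
  rw [(extChartAt 𝓘(ℝ, E) p).left_inv hx]

/-! ### Christoffel symbols and compatibility with the metric -/

/-- The field of bilinear forms `g` is symmetric and positive definite everywhere, and its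
components in the chart at `n` are differentiable at `n`. -/
structure IsMetricAt (g : BilinField E N) (n : N) : Prop where
  symm : ∀ x v w, g x v w = g x w v
  pos : ∀ x v, v ≠ 0 → 0 < g x v v
  diff : ∀ b c : E, DifferentiableAt ℝ (metricCoord g n b c) (extChartAt 𝓘(ℝ, E) n n)

/-- The vector field `W` along `φ` is differentiable at `p`: its components in the chart at `φ p`
are. -/
def DiffAlong (φ : M → N) (W : (q : M) → TangentSpace 𝓘(ℝ, E) (φ q)) (p : M) : Prop :=
  MDifferentiableAt 𝓘(ℝ, E') 𝓘(ℝ, E) (coordAlong φ W p) p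

/-- The components of `g` in the chart at `n`, bundled as a bilinear form on the model space. -/
def metricCoordL (g : BilinField E N) (n : N) (y : E) : E →L[ℝ] E →L[ℝ] ℝ :=
  ContinuousLinearMap.precomp ℝ
      (mfderiv 𝓘(ℝ, E) 𝓘(ℝ, E) (extChartAt 𝓘(ℝ, E) n).symm y : E →L[ℝ] _) ∘L
    g ((extChartAt 𝓘(ℝ, E) n).symm y) ∘L
      (mfderiv 𝓘(ℝ, E) 𝓘(ℝ, E) (extChartAt 𝓘(ℝ, E) n).symm y : E →L[ℝ] _)

theorem IsMetricAt.differentiableAt_metricCoordL [FiniteDimensional ℝ E] {g : BilinField E N}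
    {n : N} (hg : IsMetricAt g n) :
    DifferentiableAt ℝ (metricCoordL g n) (extChartAt 𝓘(ℝ, E) n n) :=
  differentiableAt_clm_of_apply fun b => differentiableAt_clm_of_apply fun c => hg.diff b c

theorem IsMetricAt.fderiv_metricCoord [FiniteDimensional ℝ E] {g : BilinField E N}
    {n : N} (hg : IsMetricAt g n) (a b c : E) :
    fderiv ℝ (metricCoord g n b c) (extChartAt 𝓘(ℝ, E) n n) a =
      fderiv ℝ (metricCoordL g n) (extChartAt 𝓘(ℝ, E) n n) a b c := by
  have h := hg.differentiableAt_metricCoordL.hasFDerivAt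
  have h1 := (h.clm_apply (hasFDerivAt_const b _)).clm_apply (hasFDerivAt_const c _)
  have h2 : HasFDerivAt (metricCoord g n b c) _ _ := h1
  rw [h2.fderiv]
  simp

theorem metricCoord_symm {g : BilinField E N} {n : N} (hg : IsMetricAt g n) (b c : E) :
    metricCoord g n b c = metricCoord g n c b := by
  funext y
  exact hg.symm _ _ _

/-- A tangent vector at `p` as its coordinate vector in the chart at `p`, inverse to `ofModel`. -/
def toModel (p : N) (v : TangentSpace 𝓘(ℝ, E) p) : E := v

/-- The derivative `∂_a g(b, c)` at `n` of the components of `g` in the chart at `n`. -/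
def metricDeriv (g : BilinField E N) (n : N) (a b c : TangentSpace 𝓘(ℝ, E) n) : ℝ :=
  fderiv ℝ (metricCoordL g n) (extChartAt 𝓘(ℝ, E) n n) (toModel n a) (toModel n b) (toModel n c)

theorem metricDeriv_symm [FiniteDimensional ℝ E] {g : BilinField E N} {n : N}
    (hg : IsMetricAt g n) (a b c : TangentSpace 𝓘(ℝ, E) n) :
    metricDeriv g n a b c = metricDeriv g n a c b := by
  unfold metricDeriv
  rw [← hg.fderiv_metricCoord, ← hg.fderiv_metricCoord, metricCoord_symm hg]

theorem metricDeriv_add_left (g : BilinField E N) (n : N) (a a' b c : TangentSpace 𝓘(ℝ, E) n) :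
    metricDeriv g n (a + a') b c = metricDeriv g n a b c + metricDeriv g n a' b c := by
  have h : toModel n (a + a') = toModel n a + toModel n a' := rfl
  simp only [metricDeriv, h, map_add, add_apply]

theorem metricDeriv_add_middle (g : BilinField E N) (n : N) (a b b' c : TangentSpace 𝓘(ℝ, E) n) :
    metricDeriv g n a (b + b') c = metricDeriv g n a b c + metricDeriv g n a b' c := by
  have h : toModel n (b + b') = toModel n b + toModel n b' := rfl
  simp only [metricDeriv, h, map_add, add_apply]

/-- The defining property of the Christoffel symbols: the right-hand side is linear in `c`, because
the metric is differentiable, so that `riesz` represents it. -/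
theorem christoffel_spec [FiniteDimensional ℝ E] {g : BilinField E N} {n : N}
    (hg : IsMetricAt g n) (a b c : TangentSpace 𝓘(ℝ, E) n) :
    g n (christoffel g n a b) c =
      (metricDeriv g n a b c + metricDeriv g n b a c - metricDeriv g n c a b) / 2 := by
  let A := fderiv ℝ (metricCoordL g n) (extChartAt 𝓘(ℝ, E) n n)
  let L : E →ₗ[ℝ] ℝ :=
    { toFun := fun c => (A (toModel n a) (toModel n b) c + A (toModel n b) (toModel n a) c
        - A c (toModel n a) (toModel n b)) / 2
      map_add' := by intro x y; simp only [map_add, add_apply]; ring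
      map_smul' := by
        intro r x
        simp only [map_smul, smul_apply, smul_eq_mul, RingHom.id_apply]; ring }
  let L' : TangentSpace 𝓘(ℝ, E) n →ₗ[ℝ] ℝ := L
  have h2 : christoffel g n a b = riesz (g n) L' := by
    unfold christoffel
    congr 1
    funext c
    have h1 := hg.fderiv_metricCoord (toModel n a) (toModel n b) (toModel n c)
    have h3 := hg.fderiv_metricCoord (toModel n b) (toModel n a) (toModel n c)
    have h4 := hg.fderiv_metricCoord (toModel n c) (toModel n a) (toModel n b)
    unfold toModel at h1 h3 h4
    rw [h1, h3, h4]
    rfl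
  rw [h2, riesz_spec (g n) (hg.pos n) L' c]
  rfl

/-- A vector is determined by its scalar products. -/
theorem IsMetricAt.ext {g : BilinField E N} {n : N}
    (hg : IsMetricAt g n) {x : N} {v w : TangentSpace 𝓘(ℝ, E) x} (h : ∀ c, g x v c = g x w c) :
    v = w := by
  by_contra hne
  have h1 := hg.pos x (v - w) (sub_ne_zero.2 hne)
  have h2 : g x (v - w) (v - w) = g x v (v - w) - g x w (v - w) := by
    rw [map_sub (g x) v w]; rfl
  rw [h2, h (v - w), sub_self] at h1
  exact lt_irrefl _ h1

theorem christoffel_add_left [FiniteDimensional ℝ E] {g : BilinField E N} {n : N}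
    (hg : IsMetricAt g n) (a a' b : TangentSpace 𝓘(ℝ, E) n) :
    christoffel g n (a + a') b = christoffel g n a b + christoffel g n a' b := by
  refine hg.ext fun c => ?_
  have h : g n (christoffel g n a b + christoffel g n a' b) c =
    g n (christoffel g n a b) c + g n (christoffel g n a' b) c := by rw [map_add]; rfl
  rw [h]
  simp only [christoffel_spec hg, metricDeriv_add_left, metricDeriv_add_middle]
  ring

theorem christoffel_symm [FiniteDimensional ℝ E] {g : BilinField E N} {n : N}
    (hg : IsMetricAt g n) (a b : TangentSpace 𝓘(ℝ, E) n) :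
    christoffel g n a b = christoffel g n b a := by
  refine hg.ext fun c => ?_
  rw [christoffel_spec hg, christoffel_spec hg, metricDeriv_symm hg c a b]
  ring

/-- The differential at `x` of the chart at `n`, with values in the model space. -/
def chartD (n x : N) : TangentSpace 𝓘(ℝ, E) x →L[ℝ] E :=
  mfderiv 𝓘(ℝ, E) 𝓘(ℝ, E) (extChartAt 𝓘(ℝ, E) n) x

theorem chartD_self [IsManifold 𝓘(ℝ, E) 1 N] (n : N) (v : TangentSpace 𝓘(ℝ, E) n) :
    chartD n n v = toModel n v := by
  unfold chartD
  rw [mfderiv_extChartAt_self]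
  rfl

theorem metric_eq_metricCoord [IsManifold 𝓘(ℝ, E) 1 N] (g : BilinField E N) {n x : N}
    (hx : x ∈ (extChartAt 𝓘(ℝ, E) n).source) (v w : TangentSpace 𝓘(ℝ, E) x) :
    g x v w = metricCoordL g n (extChartAt 𝓘(ℝ, E) n x)
      (chartD n x v) (chartD n x w) := by
  obtain ⟨y, hy, rfl⟩ : ∃ y ∈ (extChartAt 𝓘(ℝ, E) n).target,
      (extChartAt 𝓘(ℝ, E) n).symm y = x :=
    ⟨_, (extChartAt 𝓘(ℝ, E) n).map_source hx, (extChartAt 𝓘(ℝ, E) n).left_inv hx⟩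
  rw [(extChartAt 𝓘(ℝ, E) n).right_inv hy]
  have h := mfderiv_symm_extChartAt_apply hy
  exact congrArg₂ (fun a b => g _ a b) (h v).symm (h w).symm

theorem coordAlong_self {M : Type*} [IsManifold 𝓘(ℝ, E) 1 N] (φ : M → N)
    (W : (q : M) → TangentSpace 𝓘(ℝ, E) (φ q)) (p : M) : coordAlong φ W p p = toModel (φ p) (W p) :=
  chartD_self _ _

theorem eventually_mem_chart {φ : M → N} {p : M} (hφ : ContinuousAt φ p) :
    ∀ᶠ q in 𝓝 p, φ q ∈ (extChartAt 𝓘(ℝ, E) (φ p)).source :=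
  hφ.eventually (extChartAt_source_mem_nhds (I := 𝓘(ℝ, E)) (φ p))

theorem metric_along_eventuallyEq [IsManifold 𝓘(ℝ, E) 1 N] (g : BilinField E N) {φ : M → N} {p : M}
    (hφ : ContinuousAt φ p) (V W : (q : M) → TangentSpace 𝓘(ℝ, E) (φ q)) :
    (fun q => g (φ q) (V q) (W q)) =ᶠ[𝓝 p] fun q =>
      metricCoordL g (φ p) (extChartAt 𝓘(ℝ, E) (φ p) (φ q)) (coordAlong φ V p q)
        (coordAlong φ W p q) := by
  filter_upwards [eventually_mem_chart (E := E) hφ] with q hq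
  exact metric_eq_metricCoord (E := E) g hq _ _

theorem mdifferentiableAt_chart_comp [IsManifold 𝓘(ℝ, E) 1 N] {F : Type*} [NormedAddCommGroup F]
    [NormedSpace ℝ F] {φ : M → N} {p : M}
    (hφ : MDifferentiableAt 𝓘(ℝ, E') 𝓘(ℝ, E) φ p) {A : E → F}
    (hA : DifferentiableAt ℝ A (extChartAt 𝓘(ℝ, E) (φ p) (φ p))) :
    MDifferentiableAt 𝓘(ℝ, E') 𝓘(ℝ, F) (fun q => A (extChartAt 𝓘(ℝ, E) (φ p) (φ q))) p :=
  hA.mdifferentiableAt.comp p ((mdifferentiableAt_extChartAt (mem_chart_source E (φ p))).comp p hφ)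

theorem mvfderiv_chart_comp [IsManifold 𝓘(ℝ, E) 1 N] {F : Type*} [NormedAddCommGroup F]
    [NormedSpace ℝ F] {φ : M → N} {p : M}
    (hφ : MDifferentiableAt 𝓘(ℝ, E') 𝓘(ℝ, E) φ p) {A : E → F}
    (hA : DifferentiableAt ℝ A (extChartAt 𝓘(ℝ, E) (φ p) (φ p))) (u : TangentSpace 𝓘(ℝ, E') p) :
    mvfderiv 𝓘(ℝ, E') (fun q => A (extChartAt 𝓘(ℝ, E) (φ p) (φ q))) p u =
      fderiv ℝ A (extChartAt 𝓘(ℝ, E) (φ p) (φ p)) (mfderiv 𝓘(ℝ, E') 𝓘(ℝ, E) φ p u) := by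
  have h1 := (mdifferentiableAt_extChartAt (I := 𝓘(ℝ, E)) (mem_chart_source E (φ p)))
  have h2 := mfderiv_comp p hA.mdifferentiableAt (h1.comp p hφ)
  have h3 := mfderiv_comp p h1 hφ
  rw [mfderiv_extChartAt_self] at h3
  rw [h3, mfderiv_eq_fderiv] at h2
  exact congrArg (fun L : E' →L[ℝ] F => L u) h2

/-- The metric is parallel along `φ`. -/
theorem mvfderiv_metric [IsManifold 𝓘(ℝ, E) 1 N] [FiniteDimensional ℝ E] {g : BilinField E N}
    {φ : M → N} {p : M} (hg : IsMetricAt g (φ p))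
    (hφ : MDifferentiableAt 𝓘(ℝ, E') 𝓘(ℝ, E) φ p)
    {V W : (q : M) → TangentSpace 𝓘(ℝ, E) (φ q)} (hV : DiffAlong (E' := E') φ V p)
    (hW : DiffAlong (E' := E') φ W p) (u : TangentSpace 𝓘(ℝ, E') p) :
    MDifferentiableAt 𝓘(ℝ, E') 𝓘(ℝ, ℝ) (fun q => g (φ q) (V q) (W q)) p ∧
    mvfderiv 𝓘(ℝ, E') (fun q => g (φ q) (V q) (W q)) p u =
      g (φ p) (covAlong g φ V p u) (W p) + g (φ p) (V p) (covAlong g φ W p u) := by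
  have hev := metric_along_eventuallyEq g hφ.continuousAt V W
  have hA := mdifferentiableAt_chart_comp (F := E →L[ℝ] E →L[ℝ] ℝ) hφ
    hg.differentiableAt_metricCoordL
  refine ⟨((hA.clm_apply hV).clm_apply hW).congr_of_eventuallyEq hev, ?_⟩
  rw [mvfderiv_congr hev, mvfderiv_clm_apply (hA.clm_apply hV) hW, mvfderiv_clm_apply hA hV,
    mvfderiv_chart_comp (F := E →L[ℝ] E →L[ℝ] ℝ) hφ
      hg.differentiableAt_metricCoordL, coordAlong_self, coordAlong_self]
  have hp : ∀ v w : TangentSpace 𝓘(ℝ, E) (φ p),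
      metricCoordL g (φ p) (extChartAt 𝓘(ℝ, E) (φ p) (φ p)) (toModel _ v) (toModel _ w) =
        g (φ p) v w := by
    intro v w
    rw [metric_eq_metricCoord g (mem_extChartAt_source (φ p)) v w, chartD_self, chartD_self]
  have h1 := hp (ofModel (φ p) (mvfderiv 𝓘(ℝ, E') (coordAlong φ V p) p u)) (W p)
  have h2 := hp (V p) (ofModel (φ p) (mvfderiv 𝓘(ℝ, E') (coordAlong φ W p) p u))
  have h3 : g (φ p) (covAlong g φ V p u) (W p) =
      g (φ p) (ofModel (φ p) (mvfderiv 𝓘(ℝ, E') (coordAlong φ V p) p u)) (W p)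
      + g (φ p) (christoffel g (φ p) (mfderiv 𝓘(ℝ, E') 𝓘(ℝ, E) φ p u) (V p)) (W p) := by
    unfold covAlong
    rw [map_add]
    rfl
  have h4 : g (φ p) (V p) (covAlong g φ W p u) =
      g (φ p) (V p) (ofModel (φ p) (mvfderiv 𝓘(ℝ, E') (coordAlong φ W p) p u))
      + g (φ p) (V p) (christoffel g (φ p) (mfderiv 𝓘(ℝ, E') 𝓘(ℝ, E) φ p u) (W p)) := by
    unfold covAlong
    rw [map_add]
  rw [h3, h4, ← h1, ← h2, hg.symm _ (V p), christoffel_spec hg, christoffel_spec hg,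
    metricDeriv_symm hg (W p) _ (V p), add_apply]
  have h5 : fderiv ℝ (metricCoordL g (φ p)) (extChartAt 𝓘(ℝ, E) (φ p) (φ p))
      (mfderiv 𝓘(ℝ, E') 𝓘(ℝ, E) φ p u) (toModel (φ p) (V p)) (toModel (φ p) (W p)) =
    metricDeriv g (φ p) (mfderiv 𝓘(ℝ, E') 𝓘(ℝ, E) φ p u) (V p) (W p) := rfl
  rw [h5, metricDeriv_symm hg (mfderiv 𝓘(ℝ, E') 𝓘(ℝ, E) φ p u) (W p) (V p)]
  simp only [ofModel, toModel]
  ring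

/-! ### Absence of torsion along an immersion -/

/-- The expression of `ι` in the charts at `p` and `ι p`. -/
def chartExpr (E' E : Type*) [NormedAddCommGroup E'] [NormedSpace ℝ E']
    [NormedAddCommGroup E] [NormedSpace ℝ E]
    {M : Type*} [TopologicalSpace M] [ChartedSpace E' M]
    {N : Type*} [TopologicalSpace N] [ChartedSpace E N] (ι : M → N) (p : M) (y : E') : E :=
  extChartAt 𝓘(ℝ, E) (ι p) (ι ((extChartAt 𝓘(ℝ, E') p).symm y))

theorem contDiffAt_chartExpr [IsManifold 𝓘(ℝ, E) ∞ N] [IsManifold 𝓘(ℝ, E') ∞ M] {ι : M → N}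
    (hι : ContMDiff 𝓘(ℝ, E') 𝓘(ℝ, E) ∞ ι) (p : M) :
    ContDiffAt ℝ ∞ (chartExpr E' E ι p) (extChartAt 𝓘(ℝ, E') p p) := by
  have := (contMDiffAt_iff.1 (hι p)).2
  rwa [ModelWithCorners.range_eq_univ, contDiffWithinAt_univ] at this

theorem mdifferentiable_of_smooth {ι : M → N}
    (hι : ContMDiff 𝓘(ℝ, E') 𝓘(ℝ, E) ∞ ι) (p : M) : MDifferentiableAt 𝓘(ℝ, E') 𝓘(ℝ, E) ι p :=
  (hι p).mdifferentiableAt (by simp)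

theorem chartD_dmap [IsManifold 𝓘(ℝ, E) ∞ N] [IsManifold 𝓘(ℝ, E') ∞ M] {ι : M → N}
    (hι : ContMDiff 𝓘(ℝ, E') 𝓘(ℝ, E) ∞ ι) (p : M) :
    ∀ᶠ q in 𝓝 p, ∀ v : TangentSpace 𝓘(ℝ, E') q, chartD (ι p) (ι q) (dmap E' E ι q v) =
      fderiv ℝ (chartExpr E' E ι p) (extChartAt 𝓘(ℝ, E') p q) (chartD p q v) := by
  have : IsManifold 𝓘(ℝ, E) 1 N := IsManifold.of_le (n := ∞) (by simp)
  have : IsManifold 𝓘(ℝ, E') 1 M := IsManifold.of_le (n := ∞) (by simp)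
  have h1 : ∀ᶠ y in 𝓝 (extChartAt 𝓘(ℝ, E') p p), DifferentiableAt ℝ (chartExpr E' E ι p) y := by
    have := ((contDiffAt_chartExpr hι p).of_le (m := 1) (by simp)).eventually (by simp)
    filter_upwards [this] with y hy using hy.differentiableAt (by simp)
  have h2 := (continuousAt_extChartAt (I := 𝓘(ℝ, E')) p).eventually h1
  have h3 := extChartAt_source_mem_nhds (I := 𝓘(ℝ, E')) p
  have h4 := eventually_mem_chart (E := E) hι.continuous.continuousAt (p := p)
  filter_upwards [h2, h3, h4] with q hq2 hq3 hq4 v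
  rw [extChartAt_source] at hq3 hq4
  have e1 := mfderiv_comp q (mdifferentiableAt_extChartAt (I := 𝓘(ℝ, E)) hq4)
    (mdifferentiable_of_smooth hι q)
  have e2 := mfderiv_comp q hq2.mdifferentiableAt
    (mdifferentiableAt_extChartAt (I := 𝓘(ℝ, E')) hq3)
  have e3 : (chartExpr E' E ι p) ∘ (extChartAt 𝓘(ℝ, E') p) =ᶠ[𝓝 q]
      (extChartAt 𝓘(ℝ, E) (ι p)) ∘ ι := by
    filter_upwards [(chartAt E' p).open_source.mem_nhds hq3] with x hx
    simp only [Function.comp, chartExpr]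
    rw [(extChartAt 𝓘(ℝ, E') p).left_inv (by rwa [extChartAt_source])]
  have e4 := e3.mfderiv_eq (I := 𝓘(ℝ, E')) (I' := 𝓘(ℝ, E))
  rw [mfderiv_eq_fderiv] at e2
  have e5 := (e1.symm.trans (e4.symm.trans e2))
  exact congrArg (fun L : TangentSpace 𝓘(ℝ, E') q →L[ℝ] E => L v) e5

theorem coordAlong_dmap [IsManifold 𝓘(ℝ, E) ∞ N] [IsManifold 𝓘(ℝ, E') ∞ M] {ι : M → N}
    (hι : ContMDiff 𝓘(ℝ, E') 𝓘(ℝ, E) ∞ ι) (p : M) (Y : VField E' M) :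
    coordAlong ι (fun q => dmap E' E ι q (Y q)) p =ᶠ[𝓝 p] fun q =>
      fderiv ℝ (chartExpr E' E ι p) (extChartAt 𝓘(ℝ, E') p q) (coordAlong id Y p q) := by
  filter_upwards [chartD_dmap hι p] with q hq
  exact hq (Y q)

theorem differentiableAt_fderiv_chartExpr [IsManifold 𝓘(ℝ, E) ∞ N] [IsManifold 𝓘(ℝ, E') ∞ M]
    {ι : M → N} (hι : ContMDiff 𝓘(ℝ, E') 𝓘(ℝ, E) ∞ ι) (p : M) :
    DifferentiableAt ℝ (fderiv ℝ (chartExpr E' E ι p)) (extChartAt 𝓘(ℝ, E') p p) :=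
  ((contDiffAt_chartExpr hι p).fderiv_right (m := 1) 
    (by rw [one_add_one_eq_two]; exact WithTop.coe_le_coe.2 le_top)).differentiableAt
    (by simp)

theorem diffAlong_dmap [IsManifold 𝓘(ℝ, E) ∞ N] [IsManifold 𝓘(ℝ, E') ∞ M]
    {ι : M → N} (hι : ContMDiff 𝓘(ℝ, E') 𝓘(ℝ, E) ∞ ι) {p : M} {Y : VField E' M}
    (hY : DiffAlong (E' := E') id Y p) :
    DiffAlong (E' := E') ι (fun q => dmap E' E ι q (Y q)) p := by
  have : IsManifold 𝓘(ℝ, E') 1 M := IsManifold.of_le (n := ∞) (by simp)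
  have hA := mdifferentiableAt_chart_comp (mdifferentiableAt_id (I := 𝓘(ℝ, E')) (x := p))
    (differentiableAt_fderiv_chartExpr hι p)
  exact (hA.clm_apply hY).congr_of_eventuallyEq (coordAlong_dmap hι p Y)

theorem fderiv_chartExpr_self [IsManifold 𝓘(ℝ, E) ∞ N] [IsManifold 𝓘(ℝ, E') ∞ M]
    {ι : M → N} (hι : ContMDiff 𝓘(ℝ, E') 𝓘(ℝ, E) ∞ ι) (p : M) (v : TangentSpace 𝓘(ℝ, E') p) :
    fderiv ℝ (chartExpr E' E ι p) (extChartAt 𝓘(ℝ, E') p p) (toModel p v) =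
      toModel (ι p) (dmap E' E ι p v) := by
  have : IsManifold 𝓘(ℝ, E) 1 N := IsManifold.of_le (n := ∞) (by simp)
  have : IsManifold 𝓘(ℝ, E') 1 M := IsManifold.of_le (n := ∞) (by simp)
  have := (chartD_dmap hι p).self_of_nhds v
  rw [chartD_self, chartD_self] at this
  exact this.symm

theorem mvfderiv_coordAlong_dmap [IsManifold 𝓘(ℝ, E) ∞ N] [IsManifold 𝓘(ℝ, E') ∞ M]
    {ι : M → N} (hι : ContMDiff 𝓘(ℝ, E') 𝓘(ℝ, E) ∞ ι) {p : M} {Y : VField E' M}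
    (hY : DiffAlong (E' := E') id Y p) (u : TangentSpace 𝓘(ℝ, E') p) :
    mvfderiv 𝓘(ℝ, E') (coordAlong ι (fun q => dmap E' E ι q (Y q)) p) p u =
      fderiv ℝ (fderiv ℝ (chartExpr E' E ι p)) (extChartAt 𝓘(ℝ, E') p p) (toModel p u)
        (toModel p (Y p))
      + toModel (ι p) (dmap E' E ι p (ofModel p (mvfderiv 𝓘(ℝ, E') (coordAlong id Y p) p u))) := by
  have : IsManifold 𝓘(ℝ, E') 1 M := IsManifold.of_le (n := ∞) (by simp)
  have hA := mdifferentiableAt_chart_comp (mdifferentiableAt_id (I := 𝓘(ℝ, E')) (x := p))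
    (differentiableAt_fderiv_chartExpr hι p)
  rw [mvfderiv_congr (coordAlong_dmap hι p Y)]
  have h1 := mvfderiv_clm_apply hA hY u
  have h2 := mvfderiv_chart_comp (mdifferentiableAt_id (I := 𝓘(ℝ, E')) (x := p))
    (differentiableAt_fderiv_chartExpr hι p) u
  rw [h2, mfderiv_id, coordAlong_self] at h1
  rw [← fderiv_chartExpr_self hι]
  exact h1

theorem mlieBracket_eq [IsManifold 𝓘(ℝ, E') ∞ M] {X Y : VField E' M} {p : M}
    (hX : DiffAlong (E' := E') id X p) (hY : DiffAlong (E' := E') id Y p) :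
    VectorField.mlieBracket 𝓘(ℝ, E') X Y p =
      ofModel p (mvfderiv 𝓘(ℝ, E') (coordAlong id Y p) p (X p)) -
        ofModel p (mvfderiv 𝓘(ℝ, E') (coordAlong id X p) p (Y p)) := by
  have : IsManifold 𝓘(ℝ, E') 1 M := IsManifold.of_le (n := ∞) (by simp)
  have key : ∀ Z : VField E' M,
      VectorField.mpullbackWithin 𝓘(ℝ, E') 𝓘(ℝ, E') (extChartAt 𝓘(ℝ, E') p).symm Z
        (range 𝓘(ℝ, E')) =ᶠ[𝓝 (extChartAt 𝓘(ℝ, E') p p)]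
        coordAlong id Z p ∘ (extChartAt 𝓘(ℝ, E') p).symm := by
    intro Z
    filter_upwards [extChartAt_target_mem_nhds (I := 𝓘(ℝ, E')) p] with y hy
    have h1 := mfderivWithin_extChartAt_symm_comp_mfderiv_extChartAt hy
    have h2 := mfderiv_extChartAt_comp_mfderivWithin_extChartAt_symm hy
    have h3 := ContinuousLinearMap.inverse_eq h1 h2
    rw [VectorField.mpullbackWithin_apply, h3]
    rfl
  have h5 : ∀ V W : E' → E', VectorField.lieBracketWithin ℝ V W
      ((extChartAt 𝓘(ℝ, E') p).symm ⁻¹' univ ∩ range 𝓘(ℝ, E')) (extChartAt 𝓘(ℝ, E') p p) =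
      VectorField.lieBracket ℝ V W (extChartAt 𝓘(ℝ, E') p p) := by
    intro V W
    rw [preimage_univ, univ_inter, ModelWithCorners.range_eq_univ,
      VectorField.lieBracketWithin_univ]
  have h4 := (key X).lieBracket_vectorField_eq (𝕜 := ℝ) (key Y)
  have hI : ∀ v : TangentSpace 𝓘(ℝ, E') p, (ContinuousLinearMap.id ℝ
      (TangentSpace 𝓘(ℝ, E') p)).inverse v = v := by
    intro v; rw [ContinuousLinearMap.inverse_id]; rfl
  rw [← VectorField.mlieBracketWithin_univ, VectorField.mlieBracketWithin_apply,
    mfderiv_extChartAt_self]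
  refine (hI _).trans ((h5 _ _).trans (h4.trans ?_))
  rw [VectorField.lieBracket, mvfderiv_eq_fderiv_chart hX, mvfderiv_eq_fderiv_chart hY]
  simp only [Function.comp_def, extChartAt_to_inv]
  rw [coordAlong_self, coordAlong_self]
  rfl

/-- The Levi-Civita connection is torsion-free along the immersion `ι`. -/
theorem covAlong_sub_covAlong [FiniteDimensional ℝ E] [IsManifold 𝓘(ℝ, E) ∞ N]
    [IsManifold 𝓘(ℝ, E') ∞ M] {g : BilinField E N}
    {ι : M → N} (hι : ContMDiff 𝓘(ℝ, E') 𝓘(ℝ, E) ∞ ι) {p : M} (hg : IsMetricAt g (ι p))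
    {X Y : VField E' M}
    (hX : DiffAlong (E' := E') id X p) (hY : DiffAlong (E' := E') id Y p) :
    covAlong g ι (fun q => dmap E' E ι q (Y q)) p (X p)
      - covAlong g ι (fun q => dmap E' E ι q (X q)) p (Y p) =
      dmap E' E ι p (VectorField.mlieBracket 𝓘(ℝ, E') X Y p) := by
  have hsymm : IsSymmSndFDerivAt ℝ (chartExpr E' E ι p) (extChartAt 𝓘(ℝ, E') p p) :=
    (contDiffAt_chartExpr hι p).isSymmSndFDerivAt (by simp; exact WithTop.coe_le_coe.2 le_top)
  rw [mlieBracket_eq hX hY, map_sub]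
  unfold covAlong
  rw [mvfderiv_coordAlong_dmap hι hX, mvfderiv_coordAlong_dmap hι hY,
    hsymm.eq (toModel p (Y p)) (toModel p (X p))]
  have h := christoffel_symm hg (dmap E' E ι p (X p)) (dmap E' E ι p (Y p))
  have h' : christoffel g (ι p) (mfderiv 𝓘(ℝ, E') 𝓘(ℝ, E) ι p (X p)) (dmap E' E ι p (Y p)) =
    christoffel g (ι p) (mfderiv 𝓘(ℝ, E') 𝓘(ℝ, E) ι p (Y p)) (dmap E' E ι p (X p)) := h
  rw [h']
  have h2 : ∀ a b : E, ofModel (ι p) (a + b) = ofModel (ι p) a + ofModel (ι p) b := fun _ _ => rfl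
  have h3 : ∀ a : TangentSpace 𝓘(ℝ, E) (ι p), ofModel (ι p) (toModel (ι p) a) = a := fun _ => rfl
  rw [h2, h2, h3, h3]
  abel

/-! ### Extensions of vectors and regularity of metrics -/

/-- The vector field extending `v` which is constant in the chart at `n`. -/
def constField [IsManifold 𝓘(ℝ, E) 1 N] {n : N} (v : TangentSpace 𝓘(ℝ, E) n) : VField E N :=
  FiberBundle.extend E (E := fun x : N => TangentSpace 𝓘(ℝ, E) x) v

theorem constField_self [IsManifold 𝓘(ℝ, E) 1 N] {n : N} (v : TangentSpace 𝓘(ℝ, E) n) :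
    constField v n = v :=
  FiberBundle.extend_apply_self (F := E) (E := fun x : N => TangentSpace 𝓘(ℝ, E) x) v

theorem chartD_constField [IsManifold 𝓘(ℝ, E) 1 N] {n x : N} (hx : x ∈ (chartAt E n).source)
    (v : TangentSpace 𝓘(ℝ, E) n) : chartD n x (constField v x) = toModel n v :=
  mfderiv_extChartAt_extend hx v

theorem coordAlong_constField [IsManifold 𝓘(ℝ, E) 1 N] {n : N} (v : TangentSpace 𝓘(ℝ, E) n) :
    coordAlong id (constField v) n =ᶠ[𝓝 n] fun _ => toModel n v := by
  filter_upwards [(chartAt E n).open_source.mem_nhds (mem_chart_source E n)] with x hx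
  exact chartD_constField hx v

theorem diffAlong_constField [IsManifold 𝓘(ℝ, E) 1 N] {n : N} (v : TangentSpace 𝓘(ℝ, E) n) :
    DiffAlong (E' := E) id (constField v) n :=
  mdifferentiableAt_const.congr_of_eventuallyEq (coordAlong_constField v)

theorem mvfderiv_coordAlong_constField [IsManifold 𝓘(ℝ, E) 1 N] {n : N}
    (v u : TangentSpace 𝓘(ℝ, E) n) :
    mvfderiv 𝓘(ℝ, E) (coordAlong id (constField v) n) n u = 0 := by
  rw [mvfderiv_congr (coordAlong_constField v), mvfderiv_const]
  rfl

theorem diffAlong_iff_section [IsManifold 𝓘(ℝ, E) 1 N] {Y : VField E N} {n : N} :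
    DiffAlong (E' := E) id Y n ↔ MDifferentiableAt 𝓘(ℝ, E) 𝓘(ℝ, E).tangent
      (fun x => (⟨x, Y x⟩ : TangentBundle 𝓘(ℝ, E) N)) n := by
  rw [mdifferentiableAt_totalSpace]
  have h : (fun x => (trivializationAt E (TangentSpace 𝓘(ℝ, E)) n
      (⟨x, Y x⟩ : TangentBundle 𝓘(ℝ, E) N)).2) =ᶠ[𝓝 n] coordAlong id Y n := by
    filter_upwards [(chartAt E n).open_source.mem_nhds (mem_chart_source E n)] with x hx
    have h1 := TangentBundle.continuousLinearMapAt_trivializationAt (I := 𝓘(ℝ, E)) hx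
    have h2 := congrArg (fun L : TangentSpace 𝓘(ℝ, E) x →L[ℝ] E => L (Y x)) h1
    refine Eq.trans ?_ h2
    rw [Bundle.Trivialization.continuousLinearMapAt_apply,
      Bundle.Trivialization.coe_linearMapAt_of_mem _ (by simpa using hx)]
  constructor
  · intro hY
    exact ⟨mdifferentiableAt_id, hY.congr_of_eventuallyEq h⟩
  · intro hY
    exact hY.2.congr_of_eventuallyEq h.symm

theorem SmoothField.diffAlong [IsManifold 𝓘(ℝ, E) ∞ N] {U : Set N} (hU : IsOpen U)
    {Y : VField E N} (hY : SmoothField U Y) {n : N} (hn : n ∈ U) :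
    DiffAlong (E' := E) id Y n := by
  have : IsManifold 𝓘(ℝ, E) 1 N := IsManifold.of_le (n := ∞) (by simp)
  exact diffAlong_iff_section.2
    (((hY n hn).contMDiffAt (hU.mem_nhds hn)).mdifferentiableAt (by simp))

theorem metricCoord_eventuallyEq [IsManifold 𝓘(ℝ, E) 1 N] (g : BilinField E N) (n : N) (b c : E) :
    metricCoord g n b c =ᶠ[𝓝 (extChartAt 𝓘(ℝ, E) n n)]
      (fun x => g x (constField (ofModel n b) x) (constField (ofModel n c) x)) ∘
        (extChartAt 𝓘(ℝ, E) n).symm := by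
  filter_upwards [extChartAt_target_mem_nhds (I := 𝓘(ℝ, E)) n] with y hy
  have h1 := (extChartAt 𝓘(ℝ, E) n).map_target hy
  rw [extChartAt_source] at h1
  have h2 : ∀ v : E, mfderiv 𝓘(ℝ, E) 𝓘(ℝ, E) (extChartAt 𝓘(ℝ, E) n).symm y v =
      constField (ofModel n v) ((extChartAt 𝓘(ℝ, E) n).symm y) := by
    intro v
    have h3 := mfderiv_symm_extChartAt_apply hy
      (constField (ofModel n v) ((extChartAt 𝓘(ℝ, E) n).symm y))
    have h4 := chartD_constField h1 (ofModel n v)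
    refine Eq.trans ?_ h3
    exact congrArg (fun w : E => mfderiv 𝓘(ℝ, E) 𝓘(ℝ, E) (extChartAt 𝓘(ℝ, E) n).symm y w) h4.symm
  exact congrArg₂ (fun a b => g _ a b) (h2 b) (h2 c)

theorem isMetricAt_of_mdifferentiable [IsManifold 𝓘(ℝ, E) 1 N] {g : BilinField E N} {n : N}
    (symm : ∀ x v w, g x v w = g x w v) (pos : ∀ x v, v ≠ 0 → 0 < g x v v)
    (h : ∀ b c : TangentSpace 𝓘(ℝ, E) n, MDifferentiableAt 𝓘(ℝ, E) 𝓘(ℝ, ℝ)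
      (fun x => g x (constField b x) (constField c x)) n) : IsMetricAt g n where
  symm := symm
  pos := pos
  diff b c :=
    (mdifferentiableAt_iff_chart.1 (h (ofModel n b) (ofModel n c))).2.congr_of_eventuallyEq
      (metricCoord_eventuallyEq g n b c)

theorem isMetricAt_riemannian [IsManifold 𝓘(ℝ, E) ∞ N]
    (g : ContMDiffRiemannianMetric 𝓘(ℝ, E) ∞ E (fun x : N => TangentSpace 𝓘(ℝ, E) x)) (n : N) :
    IsMetricAt g.inner n := by
  have : IsManifold 𝓘(ℝ, E) 1 N := IsManifold.of_le (n := ∞) (by simp)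
  refine isMetricAt_of_mdifferentiable g.symm g.pos fun b c => ?_
  have h : MDifferentiableAt 𝓘(ℝ, E) (𝓘(ℝ, E).prod 𝓘(ℝ))
      (fun m => TotalSpace.mk' ℝ (E := Bundle.Trivial N ℝ) m
        (g.inner m (constField b m) (constField c m))) n := by
    apply MDifferentiableAt.clm_bundle_apply₂ (F₁ := E) (F₂ := E)
    · exact g.contMDiff.contMDiffAt.mdifferentiableAt (by simp)
    · exact diffAlong_iff_section.1 (diffAlong_constField b)
    · exact diffAlong_iff_section.1 (diffAlong_constField c)
  rw [mdifferentiableAt_totalSpace] at h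
  exact h.2

theorem inducedMetric_apply (g : BilinField E N) (ι : M → N) (p : M)
    (v w : TangentSpace 𝓘(ℝ, E') p) :
    inducedMetric g ι p v w = g (ι p) (dmap E' E ι p v) (dmap E' E ι p w) := rfl

theorem isMetricAt_inducedMetric [FiniteDimensional ℝ E] [IsManifold 𝓘(ℝ, E) ∞ N]
    [IsManifold 𝓘(ℝ, E') ∞ M] {g : BilinField E N} {ι : M → N} (hι : IsSmoothImmersion E' E ι)
    (p : M) (hg : IsMetricAt g (ι p)) : IsMetricAt (E := E') (inducedMetric g ι) p := by
  have : IsManifold 𝓘(ℝ, E) 1 N := IsManifold.of_le (n := ∞) (by simp)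
  have : IsManifold 𝓘(ℝ, E') 1 M := IsManifold.of_le (n := ∞) (by simp)
  refine isMetricAt_of_mdifferentiable (fun x v w => hg.symm _ _ _) (fun x v hv => ?_)
    fun b c => ?_
  · refine hg.pos _ _ fun h => hv (hι.injective x ?_)
    rw [map_zero]
    exact h
  · exact (mvfderiv_metric hg (mdifferentiable_of_smooth hι.smooth p)
      (diffAlong_dmap hι.smooth (diffAlong_constField b))
      (diffAlong_dmap hι.smooth (diffAlong_constField c)) 0).1

/-! ### The Gauss formula -/

theorem covAlong_congr (g : BilinField E N) {φ : M → N} {p : M}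
    {V W : (q : M) → TangentSpace 𝓘(ℝ, E) (φ q)} (h : ∀ᶠ q in 𝓝 p, V q = W q)
    (u : TangentSpace 𝓘(ℝ, E') p) : covAlong g φ V p u = covAlong g φ W p u := by
  have h1 : coordAlong φ V p =ᶠ[𝓝 p] coordAlong φ W p := by
    filter_upwards [h] with q hq
    unfold coordAlong
    rw [hq]
  unfold covAlong
  rw [mvfderiv_congr h1, h.self_of_nhds]

theorem covAlong_add [IsManifold 𝓘(ℝ, E) 1 N] [FiniteDimensional ℝ E] {g : BilinField E N}
    {φ : M → N} {p : M} (hg : IsMetricAt g (φ p)) (W : (q : M) → TangentSpace 𝓘(ℝ, E) (φ q))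
    (u u' : TangentSpace 𝓘(ℝ, E') p) :
    covAlong g φ W p (u + u') = covAlong g φ W p u + covAlong g φ W p u' := by
  unfold covAlong
  rw [map_add, map_add, christoffel_add_left hg]
  have h2 : ∀ a b : E, ofModel (φ p) (a + b) = ofModel (φ p) a + ofModel (φ p) b := fun _ _ => rfl
  rw [h2]
  abel

theorem mvfderiv_inner [IsManifold 𝓘(ℝ, E) 1 N] [FiniteDimensional ℝ E] {g : BilinField E N}
    {n : N} (hg : IsMetricAt g n) {Y Z : VField E N}
    (hY : DiffAlong (E' := E) id Y n) (hZ : DiffAlong (E' := E) id Z n)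
    (u : TangentSpace 𝓘(ℝ, E) n) :
    MDifferentiableAt 𝓘(ℝ, E) 𝓘(ℝ, ℝ) (fun q => g q (Y q) (Z q)) n ∧
    mvfderiv 𝓘(ℝ, E) (fun q => g q (Y q) (Z q)) n u =
      g n (leviCivita g Y n u) (Z n) + g n (Y n) (leviCivita g Z n u) :=
  mvfderiv_metric (φ := id) (p := n) hg mdifferentiableAt_id hY hZ u

theorem leviCivita_sub_leviCivita [FiniteDimensional ℝ E] [IsManifold 𝓘(ℝ, E) ∞ N]
    {g : BilinField E N} {n : N} (hg : IsMetricAt g n) {X Y : VField E N}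
    (hX : DiffAlong (E' := E) id X n) (hY : DiffAlong (E' := E) id Y n) :
    leviCivita g Y n (X n) - leviCivita g X n (Y n) = VectorField.mlieBracket 𝓘(ℝ, E) X Y n := by
  have h := covAlong_sub_covAlong (ι := id) (p := n) (contMDiff_id (n := ∞)) hg hX hY
  have hid : ∀ (q : N) (v : TangentSpace 𝓘(ℝ, E) q), dmap E E id q v = v := by
    intro q v
    unfold dmap
    rw [mfderiv_id]
    rfl
  have hf : ∀ Y : VField E N, (fun q => dmap E E id q (Y q)) = Y := fun Y => funext fun q => hid q _
  have h2 := hid n (VectorField.mlieBracket 𝓘(ℝ, E) X Y n)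
  refine Eq.trans ?_ (h.trans h2)
  rw [hf, hf]
  rfl

/-- The Gauss formula: the tangential part of the covariant derivative along the immersion `ι` is
the Levi-Civita derivative of the induced metric. Both sides are compatible with the induced metric
and torsion-free, so that the Koszul argument identifies them. -/
theorem gauss [FiniteDimensional ℝ E] [FiniteDimensional ℝ E'] [IsManifold 𝓘(ℝ, E) ∞ N]
    [IsManifold 𝓘(ℝ, E') ∞ M] {g : BilinField E N} {ι : M → N} (hι : IsSmoothImmersion E' E ι)
    {p : M} (hg : IsMetricAt g (ι p)) {Y : VField E' M}
    (hY : DiffAlong (E' := E') id Y p) (u w : TangentSpace 𝓘(ℝ, E') p) :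
    g (ι p) (covAlong g ι (fun q => dmap E' E ι q (Y q)) p u) (dmap E' E ι p w) =
      inducedMetric g ι p (leviCivita (inducedMetric g ι) Y p u) w := by
  have : IsManifold 𝓘(ℝ, E) 1 N := IsManifold.of_le (n := ∞) (by simp)
  have : IsManifold 𝓘(ℝ, E') 1 M := IsManifold.of_le (n := ∞) (by simp)
  have hgM := isMetricAt_inducedMetric hι p hg
  -- `a X Y Z` is the defect; it is symmetric in `X, Y` and antisymmetric in `Y, Z`.
  let a : VField E' M → VField E' M → VField E' M → ℝ := fun X Y Z =>
    g (ι p) (covAlong g ι (fun q => dmap E' E ι q (Y q)) p (X p)) (dmap E' E ι p (Z p)) -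
      inducedMetric g ι p (leviCivita (inducedMetric g ι) Y p (X p)) (Z p)
  have anti : ∀ X Y Z : VField E' M, DiffAlong (E' := E') id Y p → DiffAlong (E' := E') id Z p →
      a X Y Z = - a X Z Y := by
    intro X Y Z hY hZ
    have h1 := (mvfderiv_metric hg (mdifferentiable_of_smooth hι.smooth p)
      (diffAlong_dmap hι.smooth hY) (diffAlong_dmap hι.smooth hZ) (X p)).2
    have h2 := (mvfderiv_inner hgM hY hZ (X p)).2
    have h3 := h1.symm.trans h2
    have h4 := hg.symm _ (dmap E' E ι p (Y p))
      (covAlong g ι (fun q => dmap E' E ι q (Z q)) p (X p))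
    have h5 := hgM.symm _ (Y p) (leviCivita (inducedMetric g ι) Z p (X p))
    simp only [a]
    linarith
  have symm : ∀ X Y Z : VField E' M, DiffAlong (E' := E') id X p → DiffAlong (E' := E') id Y p →
      a X Y Z = a Y X Z := by
    intro X Y Z hX hY
    have h1 := covAlong_sub_covAlong hι.smooth hg hX hY
    have h2 := leviCivita_sub_leviCivita hgM hX hY
    have h3 := congrArg (fun v => g (ι p) v (dmap E' E ι p (Z p))) h1
    have h4 := congrArg (fun v => inducedMetric g ι p v (Z p)) h2
    simp only [map_sub, sub_apply] at h3 h4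
    have h5 := inducedMetric_apply g ι p (VectorField.mlieBracket 𝓘(ℝ, E') X Y p) (Z p)
    simp only [a]
    linarith
  have hu := diffAlong_constField u
  have hw := diffAlong_constField w
  have h1 := anti (constField u) Y (constField w) hY hw
  have h2 := symm (constField u) (constField w) Y hu hw
  have h3 := anti (constField w) (constField u) Y hu hY
  have h4 := symm (constField w) Y (constField u) hw hY
  have h5 := anti Y (constField w) (constField u) hw hu
  have h6 := symm Y (constField u) (constField w) hY hu
  have h7 : a (constField u) Y (constField w) = 0 := by linarith
  simp only [a, constField_self] at h7
  linarith

/-- The normal part of `∇_u (dι Y)` depends on `Y` only through its value at `p`. -/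
theorem covAlong_sub_covAlong_constField [IsManifold 𝓘(ℝ, E) ∞ N]
    [IsManifold 𝓘(ℝ, E') ∞ M] (g : BilinField E N) {ι : M → N} (hι : IsSmoothImmersion E' E ι)
    {p : M} {Y : VField E' M}
    (hY : DiffAlong (E' := E') id Y p) (u : TangentSpace 𝓘(ℝ, E') p) :
    ∃ w, covAlong g ι (fun q => dmap E' E ι q (Y q)) p u =
      covAlong g ι (fun q => dmap E' E ι q (constField (Y p) q)) p u + dmap E' E ι p w := by
  have : IsManifold 𝓘(ℝ, E') 1 M := IsManifold.of_le (n := ∞) (by simp)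
  refine ⟨ofModel p (mvfderiv 𝓘(ℝ, E') (coordAlong id Y p) p u), ?_⟩
  unfold covAlong
  rw [mvfderiv_coordAlong_dmap hι.smooth hY,
    mvfderiv_coordAlong_dmap hι.smooth (diffAlong_constField (Y p)),
    mvfderiv_coordAlong_constField]
  beta_reduce
  rw [constField_self]
  have h0 : ofModel p (0 : E') = 0 := rfl
  have h2 : ∀ a b : E, ofModel (ι p) (a + b) = ofModel (ι p) a + ofModel (ι p) b := fun _ _ => rfl
  have h3 : ∀ a : TangentSpace 𝓘(ℝ, E) (ι p), ofModel (ι p) (toModel (ι p) a) = a := fun _ => rfl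
  rw [h2, h2, h3, h3, h0, map_zero]
  abel

/-- Paired with a normal vector, `h(u, v)` may be replaced by the full covariant derivative. -/
theorem inner_secondFF [FiniteDimensional ℝ E] [IsManifold 𝓘(ℝ, E') ∞ M]
    {g : BilinField E N} {ι : M → N} {p : M} (hg : IsMetricAt g (ι p))
    (u v : TangentSpace 𝓘(ℝ, E') p) {n : TangentSpace 𝓘(ℝ, E) (ι p)}
    (hn : n ∈ normalSpace E' g ι p) :
    g (ι p) n (secondFF g ι p u v) =
      g (ι p) n (covAlong g ι (fun q => dmap E' E ι q (constField v q)) p u) := by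
  rw [hg.symm, hg.symm _ n]
  exact inner_proj (hg.pos _) _ _ hn

/-! ### Conformal change of the metric -/

theorem conformal_apply (f : N → ℝ) (g : BilinField E N) (x : N) (v w : TangentSpace 𝓘(ℝ, E) x) :
    conformal f g x v w = Real.exp (-f x) * g x v w := rfl

theorem hasFDerivAt_metricCoord_conformal [IsManifold 𝓘(ℝ, E) 1 N] [FiniteDimensional ℝ E]
    {g : BilinField E N} {n : N}
    (hg : IsMetricAt g n) {f : N → ℝ} (hf : MDifferentiableAt 𝓘(ℝ, E) 𝓘(ℝ, ℝ) f n) (b c : E) :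
    HasFDerivAt (metricCoord (conformal f g) n b c)
      (Real.exp (-f n) • fderiv ℝ (metricCoord g n b c) (extChartAt 𝓘(ℝ, E) n n)
        + metricCoord g n b c (extChartAt 𝓘(ℝ, E) n n) •
          (Real.exp (-f n) •
            -fderiv ℝ (f ∘ (extChartAt 𝓘(ℝ, E) n).symm) (extChartAt 𝓘(ℝ, E) n n)))
      (extChartAt 𝓘(ℝ, E) n n) := by
  have h1 := ((mdifferentiableAt_iff_chart.1 hf).2.hasFDerivAt.neg.exp).mul
    (hg.diff b c).hasFDerivAt
  simp only [Function.comp_def, Pi.neg_apply, extChartAt_to_inv] at h1 ⊢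
  exact h1

theorem IsMetricAt.conformal [IsManifold 𝓘(ℝ, E) 1 N] [FiniteDimensional ℝ E]
    {g : BilinField E N} {n : N}
    (hg : IsMetricAt g n) {f : N → ℝ} (hf : MDifferentiableAt 𝓘(ℝ, E) 𝓘(ℝ, ℝ) f n) :
    IsMetricAt (LCK.conformal f g) n where
  symm x v w := by rw [conformal_apply, conformal_apply, hg.symm]
  pos x v hv := mul_pos (Real.exp_pos _) (hg.pos x v hv)
  diff b c := (hasFDerivAt_metricCoord_conformal hg hf b c).differentiableAt

theorem metricDeriv_conformal [IsManifold 𝓘(ℝ, E) 1 N] [FiniteDimensional ℝ E]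
    {g : BilinField E N} {n : N}
    (hg : IsMetricAt g n) {f : N → ℝ} (hf : MDifferentiableAt 𝓘(ℝ, E) 𝓘(ℝ, ℝ) f n)
    (a b c : TangentSpace 𝓘(ℝ, E) n) :
    metricDeriv (conformal f g) n a b c =
      Real.exp (-f n) * (metricDeriv g n a b c - mvfderiv 𝓘(ℝ, E) f n a * g n b c) := by
  have h1 := hasFDerivAt_metricCoord_conformal hg hf (toModel n b) (toModel n c)
  have h2 := congrArg (fun L : E →L[ℝ] ℝ => L (toModel n a)) h1.fderiv
  have h3 := (hg.conformal hf).fderiv_metricCoord (toModel n a) (toModel n b) (toModel n c)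
  have h4 := hg.fderiv_metricCoord (toModel n a) (toModel n b) (toModel n c)
  have h5 : metricCoord g n (toModel n b) (toModel n c) (extChartAt 𝓘(ℝ, E) n n) = g n b c := by
    rw [metric_eq_metricCoord g (mem_extChartAt_source n) b c, chartD_self, chartD_self]
    rfl
  have h6 := mvfderiv_eq_fderiv_chart hf a
  have h7 : metricDeriv g n a b c = fderiv ℝ (metricCoordL g n) (extChartAt 𝓘(ℝ, E) n n)
    (toModel n a) (toModel n b) (toModel n c) := rfl
  have h8 : metricDeriv (conformal f g) n a b c =
    fderiv ℝ (metricCoordL (conformal f g) n) (extChartAt 𝓘(ℝ, E) n n)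
    (toModel n a) (toModel n b) (toModel n c) := rfl
  have h9 : fderiv ℝ (f ∘ (extChartAt 𝓘(ℝ, E) n).symm) (extChartAt 𝓘(ℝ, E) n n) (toModel n a) =
    mvfderiv 𝓘(ℝ, E) f n a := h6.symm
  rw [h8, ← h3, h2, h5]
  simp only [add_apply, smul_apply, neg_apply, smul_eq_mul]
  rw [h4, ← h7, h9]
  ring

/-- The Christoffel symbols under a conformal change of the metric, `B` being the gradient
of `f`. -/
theorem christoffel_conformal [IsManifold 𝓘(ℝ, E) 1 N] [FiniteDimensional ℝ E]
    {g : BilinField E N} {n : N}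
    (hg : IsMetricAt g n) {f : N → ℝ} (hf : MDifferentiableAt 𝓘(ℝ, E) 𝓘(ℝ, ℝ) f n)
    {B : TangentSpace 𝓘(ℝ, E) n} (hB : ∀ c, g n B c = mvfderiv 𝓘(ℝ, E) f n c)
    (a b : TangentSpace 𝓘(ℝ, E) n) :
    christoffel (conformal f g) n a b = christoffel g n a b
      - (1 / 2 : ℝ) • (g n B a • b + g n B b • a - g n a b • B) := by
  refine hg.ext fun c => ?_
  have h1 := christoffel_spec (hg.conformal hf) a b c
  rw [conformal_apply, metricDeriv_conformal hg hf, metricDeriv_conformal hg hf,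
    metricDeriv_conformal hg hf] at h1
  have h2 := christoffel_spec hg a b c
  have h3 := Real.exp_pos (-f n)
  have h4 : g n (christoffel (conformal f g) n a b) c =
      ((metricDeriv g n a b c - mvfderiv 𝓘(ℝ, E) f n a * g n b c) +
        (metricDeriv g n b a c - mvfderiv 𝓘(ℝ, E) f n b * g n a c) -
        (metricDeriv g n c a b - mvfderiv 𝓘(ℝ, E) f n c * g n a b)) / 2 := by
    apply mul_left_cancel₀ h3.ne'
    rw [h1]
    ring
  have h5 : g n (christoffel g n a b
      - (1 / 2 : ℝ) • (g n B a • b + g n B b • a - g n a b • B)) c =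
      g n (christoffel g n a b) c
      - (1 / 2 : ℝ) * (g n B a * g n b c + g n B b * g n a c - g n a b * g n B c) := by
    simp only [map_sub, map_smul, map_add, sub_apply, smul_apply, add_apply, smul_eq_mul]
  rw [h4, h5, h2, hB, hB, hB]
  ring

/-! ### The almost complex structure -/

/-- The endomorphism field `J` in the trivialization of the tangent bundle by the chart at `n`. -/
def endCoord [IsManifold 𝓘(ℝ, E) 1 N] (J : EndField E N) (n x : N) : E →L[ℝ] E :=
  ContinuousLinearMap.inCoordinates E (fun x : N => TangentSpace 𝓘(ℝ, E) x) E
    (fun x : N => TangentSpace 𝓘(ℝ, E) x) n x n x (J x)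

theorem endCoord_chartD [IsManifold 𝓘(ℝ, E) 1 N] (J : EndField E N) {n x : N}
    (hx : x ∈ (chartAt E n).source) (v : TangentSpace 𝓘(ℝ, E) x) :
    endCoord J n x (chartD n x v) = chartD n x (J x v) := by
  have h1 := TangentBundle.continuousLinearMapAt_trivializationAt (I := 𝓘(ℝ, E)) hx
  have h2 : ∀ w : TangentSpace 𝓘(ℝ, E) x, chartD n x w =
      (trivializationAt E (fun x : N => TangentSpace 𝓘(ℝ, E) x) n).continuousLinearMapAt ℝ x w :=
    fun w => (congrArg (fun L : TangentSpace 𝓘(ℝ, E) x →L[ℝ] E => L w) h1).symm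
  have h3 : x ∈ (trivializationAt E (fun x : N => TangentSpace 𝓘(ℝ, E) x) n).baseSet := by
    simpa using hx
  rw [h2, h2]
  unfold endCoord ContinuousLinearMap.inCoordinates
  simp only [ContinuousLinearMap.comp_apply]
  rw [Bundle.Trivialization.symmL_continuousLinearMapAt _ h3]

theorem IsAlmostHermitian.mdifferentiableAt_endCoord [IsManifold 𝓘(ℝ, E) ∞ N]
    [IsManifold 𝓘(ℝ, E) 1 N]
    {g : BilinField E N} {J : EndField E N} (hJ : IsAlmostHermitian g J) (n : N) :
    MDifferentiableAt 𝓘(ℝ, E) 𝓘(ℝ, E →L[ℝ] E) (endCoord J n) n := by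
  have h := (contMDiffAt_hom_bundle _).1 (hJ.smooth n)
  exact h.2.mdifferentiableAt (by simp)

theorem coordAlong_end [IsManifold 𝓘(ℝ, E) 1 N] (J : EndField E N) {φ : M → N} {p : M}
    (hφ : ContinuousAt φ p) (W : (q : M) → TangentSpace 𝓘(ℝ, E) (φ q)) :
    coordAlong φ (fun q => J (φ q) (W q)) p =ᶠ[𝓝 p]
      fun q => endCoord J (φ p) (φ q) (coordAlong φ W p q) := by
  filter_upwards [eventually_mem_chart (E := E) hφ] with q hq
  rw [extChartAt_source] at hq
  exact (endCoord_chartD J hq (W q)).symm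

theorem diffAlong_end [IsManifold 𝓘(ℝ, E) 1 N] {J : EndField E N} {φ : M → N} {p : M}
    (hJ : MDifferentiableAt 𝓘(ℝ, E) 𝓘(ℝ, E →L[ℝ] E) (endCoord J (φ p)) (φ p))
    (hφ : MDifferentiableAt 𝓘(ℝ, E') 𝓘(ℝ, E) φ p)
    {W : (q : M) → TangentSpace 𝓘(ℝ, E) (φ q)} (hW : DiffAlong (E' := E') φ W p) :
    DiffAlong (E' := E') φ (fun q => J (φ q) (W q)) p :=
  ((hJ.comp p hφ).clm_apply hW).congr_of_eventuallyEq (coordAlong_end J hφ.continuousAt W)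

/-- The covariant derivative of `J W`, for a field `W` along `φ`. -/
theorem covAlong_end [IsManifold 𝓘(ℝ, E) 1 N] {J : EndField E N} (g : BilinField E N)
    {φ : M → N} {p : M}
    (hJ : MDifferentiableAt 𝓘(ℝ, E) 𝓘(ℝ, E →L[ℝ] E) (endCoord J (φ p)) (φ p))
    (hφ : MDifferentiableAt 𝓘(ℝ, E') 𝓘(ℝ, E) φ p)
    {W : (q : M) → TangentSpace 𝓘(ℝ, E) (φ q)} (hW : DiffAlong (E' := E') φ W p)
    (u : TangentSpace 𝓘(ℝ, E') p) :
    covAlong g φ (fun q => J (φ q) (W q)) p u =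
      ofModel (φ p) (mvfderiv 𝓘(ℝ, E) (endCoord J (φ p)) (φ p) (mfderiv 𝓘(ℝ, E') 𝓘(ℝ, E) φ p u)
        (toModel (φ p) (W p)))
      + J (φ p) (ofModel (φ p) (mvfderiv 𝓘(ℝ, E') (coordAlong φ W p) p u))
      + christoffel g (φ p) (mfderiv 𝓘(ℝ, E') 𝓘(ℝ, E) φ p u) (J (φ p) (W p)) := by
  unfold covAlong
  have h1 := mvfderiv_clm_apply (hJ.comp p hφ) hW u
  have h2 : mvfderiv 𝓘(ℝ, E') (endCoord J (φ p) ∘ φ) p u =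
      mvfderiv 𝓘(ℝ, E) (endCoord J (φ p)) (φ p) (mfderiv 𝓘(ℝ, E') 𝓘(ℝ, E) φ p u) :=
    congrArg (fun L : TangentSpace 𝓘(ℝ, E') p →L[ℝ] (E →L[ℝ] E) => L u) (mfderiv_comp p hJ hφ)
  have h3 : endCoord J (φ p) (φ p) (mvfderiv 𝓘(ℝ, E') (coordAlong φ W p) p u) =
      toModel (φ p) (J (φ p) (ofModel (φ p) (mvfderiv 𝓘(ℝ, E') (coordAlong φ W p) p u))) := by
    rw [← chartD_self, ← endCoord_chartD J (mem_chart_source E (φ p)), chartD_self]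
    rfl
  rw [mvfderiv_congr (coordAlong_end J hφ.continuousAt W)]
  have h4 : mvfderiv 𝓘(ℝ, E') (fun q => endCoord J (φ p) (φ q) (coordAlong φ W p q)) p u = _ := h1
  rw [h4, h2, coordAlong_self]
  have h5 : (endCoord J (φ p) ∘ φ) p = endCoord J (φ p) (φ p) := rfl
  rw [h5, h3]
  have h6 : ∀ a b : E, ofModel (φ p) (a + b) = ofModel (φ p) a + ofModel (φ p) b := fun _ _ => rfl
  have h7 : ∀ a : TangentSpace 𝓘(ℝ, E) (φ p), ofModel (φ p) (toModel (φ p) a) = a := fun _ => rfl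
  rw [h6, h7]

theorem leviCivita_eq (g : BilinField E N) (Y : VField E N) (n : N) (u : TangentSpace 𝓘(ℝ, E) n) :
    leviCivita g Y n u = ofModel n (mvfderiv 𝓘(ℝ, E) (coordAlong id Y n) n u)
      + christoffel g n u (Y n) := by
  unfold leviCivita covAlong
  rw [mfderiv_id]
  rfl

theorem leviCivita_end [IsManifold 𝓘(ℝ, E) 1 N] {J : EndField E N} (g : BilinField E N) {n : N}
    (hJ : MDifferentiableAt 𝓘(ℝ, E) 𝓘(ℝ, E →L[ℝ] E) (endCoord J n) n)
    {Y : VField E N} (hY : DiffAlong (E' := E) id Y n) (u : TangentSpace 𝓘(ℝ, E) n) :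
    leviCivita g (fun x => J x (Y x)) n u =
      ofModel n (mvfderiv 𝓘(ℝ, E) (endCoord J n) n u (toModel n (Y n)))
      + J n (ofModel n (mvfderiv 𝓘(ℝ, E) (coordAlong id Y n) n u))
      + christoffel g n u (J n (Y n)) := by
  have h := covAlong_end g (φ := id) (p := n) hJ mdifferentiableAt_id hY u
  rw [mfderiv_id] at h
  exact h

/-- If `g` is Kähler around `φ p`, then `∇ J = 0` also along `φ`. -/
theorem IsKahlerOn.covAlong_end [IsManifold 𝓘(ℝ, E) ∞ N] [IsManifold 𝓘(ℝ, E) 1 N]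
    {J : EndField E N} {g : BilinField E N} {U : Set N} (hU : IsOpen U) (hK : IsKahlerOn g J U)
    {φ : M → N} {p : M} (hp : φ p ∈ U)
    (hJ : MDifferentiableAt 𝓘(ℝ, E) 𝓘(ℝ, E →L[ℝ] E) (endCoord J (φ p)) (φ p))
    (hφ : MDifferentiableAt 𝓘(ℝ, E') 𝓘(ℝ, E) φ p)
    {W : (q : M) → TangentSpace 𝓘(ℝ, E) (φ q)} (hW : DiffAlong (E' := E') φ W p)
    (u : TangentSpace 𝓘(ℝ, E') p) :
    covAlong g φ (fun q => J (φ q) (W q)) p u = J (φ p) (covAlong g φ W p u) := by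
  obtain ⟨s, hs, hsm⟩ := FiberBundle.exists_contMDiffOn_extend (k := ∞) 𝓘(ℝ, E) E
    (V := fun x : N => TangentSpace 𝓘(ℝ, E) x) (W p)
  have hsm' : SmoothField (U ∩ interior s) (constField (W p)) :=
    hsm.mono (inter_subset_right.trans interior_subset)
  have h1 := hK (U ∩ interior s) (hU.inter isOpen_interior) inter_subset_left
    (constField (W p)) hsm' (φ p) ⟨hp, mem_interior_iff_mem_nhds.2 hs⟩
    (mfderiv 𝓘(ℝ, E') 𝓘(ℝ, E) φ p u)
  rw [leviCivita_end g hJ (diffAlong_constField (W p)), leviCivita_eq,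
    mvfderiv_coordAlong_constField, constField_self] at h1
  have h0 : ofModel (φ p) (0 : E) = 0 := rfl
  rw [h0, map_zero, add_zero, zero_add] at h1
  rw [LCK.covAlong_end g hJ hφ hW]
  unfold covAlong
  rw [map_add, ← h1]
  abel

/-- On a locally conformal Kähler manifold, `J` is parallel along `φ` for the Weyl connection
`∇_X Y - (ω(X) Y + ω(Y) X - g(X, Y) B) / 2`. -/
theorem IsLCK.covAlong_end [IsManifold 𝓘(ℝ, E) ∞ N] [FiniteDimensional ℝ E]
    {J : EndField E N} {g : BilinField E N} {lee : (x : N) → TangentSpace 𝓘(ℝ, E) x →L[ℝ] ℝ}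
    (hN : IsLCK g J lee) {φ : M → N} {p : M} (hg : IsMetricAt g (φ p))
    (hφ : MDifferentiableAt 𝓘(ℝ, E') 𝓘(ℝ, E) φ p)
    {W : (q : M) → TangentSpace 𝓘(ℝ, E) (φ q)} (hW : DiffAlong (E' := E') φ W p)
    (u : TangentSpace 𝓘(ℝ, E') p) :
    J (φ p) (covAlong g φ W p u) = covAlong g φ (fun q => J (φ q) (W q)) p u
      + (1 / 2 : ℝ) • (lee (φ p) (W p) • J (φ p) (mfderiv 𝓘(ℝ, E') 𝓘(ℝ, E) φ p u)
        - g (φ p) (mfderiv 𝓘(ℝ, E') 𝓘(ℝ, E) φ p u) (W p) • J (φ p) (leeField g lee (φ p))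
        - lee (φ p) (J (φ p) (W p)) • mfderiv 𝓘(ℝ, E') 𝓘(ℝ, E) φ p u
        + g (φ p) (mfderiv 𝓘(ℝ, E') 𝓘(ℝ, E) φ p u) (J (φ p) (W p)) • leeField g lee (φ p)) := by
  have : IsManifold 𝓘(ℝ, E) 1 N := IsManifold.of_le (n := ∞) (by simp)
  obtain ⟨U, hU, hpU, f, hf, hK, hlee⟩ := hN.locally_conformal (φ p)
  have hf' : MDifferentiableAt 𝓘(ℝ, E) 𝓘(ℝ, ℝ) f (φ p) :=
    ((hf _ hpU).contMDiffAt (hU.mem_nhds hpU)).mdifferentiableAt (by simp)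
  have hB : ∀ c, g (φ p) (leeField g lee (φ p)) c = lee (φ p) c := fun c =>
    riesz_spec (g (φ p)) (hg.pos _) (lee (φ p)).toLinearMap c
  have hB' : ∀ c, g (φ p) (leeField g lee (φ p)) c = mvfderiv 𝓘(ℝ, E) f (φ p) c := fun c =>
    (hB c).trans (hlee _ hpU c)
  have hJ := hN.almostHermitian.mdifferentiableAt_endCoord (φ p)
  have h1 := hK.covAlong_end hU hpU hJ hφ hW u
  have h2 : ∀ V : (q : M) → TangentSpace 𝓘(ℝ, E) (φ q), covAlong (conformal f g) φ V p u =
      covAlong g φ V p u - (1 / 2 : ℝ) •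
        (lee (φ p) (mfderiv 𝓘(ℝ, E') 𝓘(ℝ, E) φ p u) • V p
          + lee (φ p) (V p) • mfderiv 𝓘(ℝ, E') 𝓘(ℝ, E) φ p u
          - g (φ p) (mfderiv 𝓘(ℝ, E') 𝓘(ℝ, E) φ p u) (V p) • leeField g lee (φ p)) := by
    intro V
    unfold covAlong
    rw [christoffel_conformal hg hf' hB', hB, hB]
    abel
  rw [h2, h2] at h1
  simp only [map_sub, map_smul, map_add] at h1
  rw [sub_eq_iff_eq_add] at h1
  rw [h1]
  module

/-! ### Sections of a smooth distribution -/

theorem differentiableAt_det {n : ℕ} {A : F → Matrix (Fin n) (Fin n) ℝ} {x : F}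
    (h : ∀ i j, DifferentiableAt ℝ (fun y => A y i j) x) :
    DifferentiableAt ℝ (fun y => (A y).det) x := by
  simp only [Matrix.det_apply]
  refine DifferentiableAt.fun_sum fun σ _ => DifferentiableAt.const_smul ?_ _
  exact (HasFDerivAt.finsetProd fun i _ => (h (σ i) i).hasFDerivAt).differentiableAt

/-- The solution of a linear system with differentiable coefficients is differentiable, by Cramer's
rule. -/
theorem differentiableAt_solution {n : ℕ} {A : F → Matrix (Fin n) (Fin n) ℝ} {b c : F → Fin n → ℝ}
    {x : F} (hA : ∀ i j, DifferentiableAt ℝ (fun y => A y i j) x)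
    (hb : ∀ i, DifferentiableAt ℝ (fun y => b y i) x) (hdet : (A x).det ≠ 0)
    (h : ∀ᶠ y in 𝓝 x, Matrix.mulVec (A y) (c y) = b y) (i : Fin n) :
    DifferentiableAt ℝ (fun y => c y i) x := by
  have hd := differentiableAt_det hA
  have h1 : DifferentiableAt ℝ (fun y => ((A y).det)⁻¹ * ((A y).updateCol i (b y)).det) x := by
    refine (hd.inv hdet).mul (differentiableAt_det fun k j => ?_)
    by_cases hj : j = i
    · subst hj
      simpa only [Matrix.updateCol_self] using hb k
    · simpa only [Matrix.updateCol_ne hj] using hA k j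
  refine h1.congr_of_eventuallyEq ?_
  filter_upwards [h, hd.continuousAt.eventually_ne hdet] with y hy hy'
  have h2 : (A y).det * c y i = ((A y).updateCol i (b y)).det := by
    rw [← Matrix.cramer_apply, Matrix.cramer_eq_adjugate_mulVec, ← hy, Matrix.mulVec_mulVec,
      Matrix.adjugate_mul, Matrix.smul_mulVec, Matrix.one_mulVec]
    rfl
  rw [← h2]
  field_simp

/-- A section `Z` of a distribution with local frame `X` is differentiable as soon as its scalar
products with the frame are: its coefficients solve the linear system given by the Gram matrix. -/
theorem diffAlong_of_frame [IsManifold 𝓘(ℝ, E) 1 N] [FiniteDimensional ℝ E] {g : BilinField E N}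
    {p : N} (hg : IsMetricAt g p) {r : ℕ} {X : Fin r → VField E N}
    (hX : ∀ i, DiffAlong (E' := E) id (X i) p)
    (hli : LinearIndependent ℝ fun i => X i p) {Z : VField E N}
    (hZ : ∀ᶠ q in 𝓝 p, Z q ∈ Submodule.span ℝ (range fun i => X i q))
    (hgZ : ∀ j, MDifferentiableAt 𝓘(ℝ, E) 𝓘(ℝ, ℝ) (fun q => g q (Z q) (X j q)) p) :
    DiffAlong (E' := E) id Z p := by
  have h1 : ∀ q, ∃ c : Fin r → ℝ, Z q ∈ Submodule.span ℝ (range fun i => X i q) →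
      ∑ i, c i • X i q = Z q := by
    intro q
    by_cases h : Z q ∈ Submodule.span ℝ (range fun i => X i q)
    · obtain ⟨c, hc⟩ := (Submodule.mem_span_range_iff_exists_fun ℝ).1 h
      exact ⟨c, fun _ => hc⟩
    · exact ⟨0, fun h' => absurd h' h⟩
  choose c hc using h1
  let A : N → Matrix (Fin r) (Fin r) ℝ := fun q => Matrix.of fun j i => g q (X i q) (X j q)
  let b : N → Fin r → ℝ := fun q j => g q (Z q) (X j q)
  let s := (extChartAt 𝓘(ℝ, E) p).symm
  have hsp : s (extChartAt 𝓘(ℝ, E) p p) = p := extChartAt_to_inv p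
  have hs : ∀ {P : N → Prop}, (∀ᶠ q in 𝓝 p, P q) → ∀ᶠ y in 𝓝 (extChartAt 𝓘(ℝ, E) p p), P (s y) := by
    intro P hP
    have := continuousAt_extChartAt_symm (I := 𝓘(ℝ, E)) p
    unfold ContinuousAt at this
    rw [extChartAt_to_inv] at this
    exact this.eventually hP
  have hdet : (A p).det ≠ 0 := by
    intro h0
    obtain ⟨v, hv, hAv⟩ := Matrix.exists_mulVec_eq_zero_iff.2 h0
    apply hv
    have h2 : ∀ j, g p (∑ i, v i • X i p) (X j p) = 0 := by
      intro j
      have h3 := congrFun hAv j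
      simp only [Matrix.mulVec, dotProduct, A, Matrix.of_apply, Pi.zero_apply] at h3
      rw [map_sum]
      simp only [map_smul, sum_apply, smul_apply, smul_eq_mul]
      rw [← h3]
      exact Finset.sum_congr rfl fun i _ => mul_comm _ _
    have h4 : g p (∑ i, v i • X i p) (∑ i, v i • X i p) = 0 := by
      rw [map_sum (g p (∑ i, v i • X i p))]
      simp only [map_smul, h2, smul_zero, Finset.sum_const_zero]
    have h5 : ∑ i, v i • X i p = 0 := by
      by_contra hne
      exact (hg.pos p _ hne).ne' h4
    funext i
    exact Fintype.linearIndependent_iff.1 hli v h5 i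
  have hcd : ∀ i, DifferentiableAt ℝ (fun y => c (s y) i) (extChartAt 𝓘(ℝ, E) p p) := by
    refine differentiableAt_solution (A := A ∘ s) (b := b ∘ s) (c := c ∘ s) ?_ ?_ ?_ ?_
    · intro j i
      exact mdifferentiableAt_iff_differentiableAt_chart.1 (mvfderiv_inner hg (hX i) (hX j) 0).1
    · intro j
      exact mdifferentiableAt_iff_differentiableAt_chart.1 (hgZ j)
    · simp only [Function.comp, hsp]
      exact hdet
    · filter_upwards [hs hZ] with y hy
      funext j
      simp only [Matrix.mulVec, dotProduct, A, b, Matrix.of_apply, Function.comp]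
      rw [← hc _ hy, map_sum]
      simp only [map_smul, sum_apply, smul_apply, smul_eq_mul]
      exact Finset.sum_congr rfl fun i _ => mul_comm _ _
  have hfin : DifferentiableAt ℝ (fun y => ∑ i, c (s y) i • coordAlong id (X i) p (s y))
      (extChartAt 𝓘(ℝ, E) p p) :=
    DifferentiableAt.fun_sum fun i _ =>
      (hcd i).smul (mdifferentiableAt_iff_differentiableAt_chart.1 (hX i))
  refine mdifferentiableAt_iff_differentiableAt_chart.2 (hfin.congr_of_eventuallyEq ?_)
  filter_upwards [hs hZ] with y hy
  have h6 : coordAlong id Z p (s y) = chartD p (s y) (Z (s y)) := rfl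
  have h7 : ∀ i, coordAlong id (X i) p (s y) = chartD p (s y) (X i (s y)) := fun _ => rfl
  simp only [Function.comp, h7]
  refine h6.trans ?_
  rw [← hc _ hy, map_sum]
  simp only [map_smul]

theorem DiffAlong.sub [IsManifold 𝓘(ℝ, E) 1 N] {p : N} {X Y : VField E N}
    (hX : DiffAlong (E' := E) id X p) (hY : DiffAlong (E' := E) id Y p) :
    DiffAlong (E' := E) id (fun q => X q - Y q) p := by
  have h : coordAlong id (fun q => X q - Y q) p = coordAlong id X p - coordAlong id Y p := by
    funext q
    exact map_sub (chartD p q) (X q) (Y q)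
  unfold DiffAlong
  rw [h]
  exact MDifferentiableAt.sub hX hY

/-- Every vector of a smooth distribution extends to a local smooth section. -/
theorem IsSmoothDistribution.exists_section [IsManifold 𝓘(ℝ, E) ∞ N] {D : SubspaceField E N}
    (hD : IsSmoothDistribution D) {p : N} {v : TangentSpace 𝓘(ℝ, E) p} (hv : v ∈ D p) :
    ∃ U : Set N, IsOpen U ∧ p ∈ U ∧ ∃ Y : VField E N, SmoothSection D U Y ∧ Y p = v := by
  have : IsManifold 𝓘(ℝ, E) 1 N := IsManifold.of_le (n := ∞) (by simp)
  obtain ⟨r, hr⟩ := hD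
  obtain ⟨U, hU, hpU, X, hX, hspan⟩ := hr p
  rw [← (hspan p hpU).2] at hv
  obtain ⟨c, hc⟩ := (Submodule.mem_span_range_iff_exists_fun ℝ).1 hv
  refine ⟨U, hU, hpU, fun q => ∑ i, c i • X i q, ⟨?_, fun q hq => ?_⟩, hc⟩
  · exact ContMDiffOn.sum_section fun i _ => (hX i).const_smul_section
  · rw [← (hspan q hq).2]
    exact (Submodule.mem_span_range_iff_exists_fun ℝ).2 ⟨c, rfl⟩

/-- The orthogonal projection of a differentiable field on the complement of a smooth distribution
is differentiable. -/
theorem diffAlong_proj_orthDist [IsManifold 𝓘(ℝ, E) ∞ N] [FiniteDimensional ℝ E]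
    {g : BilinField E N} {p : N} (hg : IsMetricAt g p) {D : SubspaceField E N}
    (hD : IsSmoothDistribution D) {X : VField E N} (hX : DiffAlong (E' := E) id X p) :
    DiffAlong (E' := E) id (fun q => proj (g q) (orthDist g D q) (X q)) p := by
  have : IsManifold 𝓘(ℝ, E) 1 N := IsManifold.of_le (n := ∞) (by simp)
  obtain ⟨r, hr⟩ := hD
  obtain ⟨U, hU, hpU, B, hB, hspan⟩ := hr p
  have h1 : DiffAlong (E' := E) id (fun q => proj (g q) (D q) (X q)) p := by
    refine diffAlong_of_frame hg (fun i => (hB i).diffAlong hU hpU) (hspan p hpU).1 ?_ fun j => ?_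
    · filter_upwards [hU.mem_nhds hpU] with q hq
      rw [(hspan q hq).2]
      exact (proj_spec (g q) (hg.pos q) (D q) (X q)).1
    · refine (mvfderiv_inner hg hX ((hB j).diffAlong hU hpU) 0).1.congr_of_eventuallyEq ?_
      filter_upwards [hU.mem_nhds hpU] with q hq
      refine inner_proj (hg.pos q) (D q) (X q) ?_
      rw [← (hspan q hq).2]
      exact Submodule.subset_span ⟨j, rfl⟩
  have h2 : (fun q => proj (g q) (orthDist g D q) (X q)) =
      fun q => X q - proj (g q) (D q) (X q) := by
    funext q
    exact eq_sub_of_add_eq (proj_add_proj_perp (hg.pos q) (hg.symm q) (D q) (X q))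
  rw [h2]
  exact hX.sub h1

theorem IsSmoothDistribution.ne_bot [IsManifold 𝓘(ℝ, E) ∞ N]
    {D : SubspaceField E N} (hD : IsSmoothDistribution D)
    {p : N} (hp : D p ≠ ⊥) (q : N) : D q ≠ ⊥ := by
  obtain ⟨r, hr⟩ := hD
  obtain ⟨U, -, hpU, X, -, hX⟩ := hr p
  obtain ⟨U', -, hqU', X', -, hX'⟩ := hr q
  have hr0 : 0 < r := by
    rcases Nat.eq_zero_or_pos r with h | h
    · subst h
      exfalso
      apply hp
      rw [← (hX p hpU).2, range_eq_empty, Submodule.span_empty]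
    · exact h
  intro h
  have h1 : X' ⟨0, hr0⟩ q ∈ D q := by
    rw [← (hX' q hqU').2]
    exact Submodule.subset_span ⟨_, rfl⟩
  rw [h, Submodule.mem_bot] at h1
  exact (hX' q hqU').1.ne_zero ⟨0, hr0⟩ h1

/-! ### CR-submanifolds and bundle-like metrics -/

/-- On a holomorphic distribution, `J` is induced by vectors of the distribution. -/
theorem IsCRSubmanifold.exists_end [IsManifold 𝓘(ℝ, E') ∞ M] {g : BilinField E N}
    {J : EndField E N} {ι : M → N} {D : SubspaceField E' M}
    (hM : IsCRSubmanifold g J ι D) {p : M} {u : TangentSpace 𝓘(ℝ, E') p}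
    (hu : u ∈ D p) : ∃ ju ∈ D p, dmap E' E ι p ju = J (ι p) (dmap E' E ι p u) := by
  have h : J (ι p) (dmap E' E ι p u) ∈ pushDist E ι D p := by
    rw [← hM.holomorphic p]
    exact ⟨_, ⟨u, hu, rfl⟩, rfl⟩
  obtain ⟨ju, h1, h2⟩ := h
  exact ⟨ju, h1, h2⟩

variable [FiniteDimensional ℝ E] [IsManifold 𝓘(ℝ, E) ∞ N]
  [FiniteDimensional ℝ E'] [IsManifold 𝓘(ℝ, E') ∞ M]

/-- The induced metric on the transversal distribution is parallel in the direction of `X` exactly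
when the symmetrized second fundamental form of `D` vanishes on the leaf component of `X`: the part
of `X` in `D` contributes nothing, as `∇` is metric. -/
theorem parallel_iff {g : BilinField E N} {p : N} (hg : IsMetricAt g p) {D : SubspaceField E N}
    {X Y Z : VField E N}
    (hY : DiffAlong (E' := E) id Y p) (hZ : DiffAlong (E' := E) id Z p)
    (hYD : ∀ᶠ q in 𝓝 p, Y q ∈ D q) (hZD : ∀ᶠ q in 𝓝 p, Z q ∈ D q)
    (hW : DiffAlong (E' := E) id (fun q => proj (g q) (orthDist g D q) (X q)) p) :
    mvfderiv 𝓘(ℝ, E) (fun q => g q (Y q) (Z q)) p (X p) =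
        g p (intrinsicConn g (orthDist g D) X Y p) (Z p)
          + g p (Y p) (intrinsicConn g (orthDist g D) X Z p) ↔
      g p (proj (g p) (orthDist g D p) (X p)) (leviCivita g Z p (Y p))
        + g p (proj (g p) (orthDist g D p) (X p)) (leviCivita g Y p (Z p)) = 0 := by
  have : IsManifold 𝓘(ℝ, E) 1 N := IsManifold.of_le (n := ∞) (by simp)
  have hDD : orthDist g (orthDist g D) p = D p := perp_perp (hg.pos p) (hg.symm p) (D p)
  let W : VField E N := fun q => proj (g q) (orthDist g D q) (X q)
  have hWperp : ∀ q, ∀ d ∈ D q, g q (W q) d = 0 := fun q =>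
    (proj_spec (g q) (hg.pos q) (orthDist g D q) (X q)).1
  have hdec : proj (g p) (D p) (X p) + W p = X p := by
    rw [add_comm]
    exact proj_add_proj_perp (hg.pos p) (hg.symm p) (D p) (X p)
  -- The connection on a section `Y` of `D`, paired with a section `Z` of `D`.
  have hconn : ∀ Y Z : VField E N, DiffAlong (E' := E) id Y p → Z p ∈ D p →
      g p (intrinsicConn g (orthDist g D) X Y p) (Z p) =
        g p (leviCivita g Y p (X p)) (Z p) - g p (leviCivita g W p (Y p)) (Z p) := by
    intro Y Z hY hZp
    unfold intrinsicConn
    rw [hDD, map_add, add_apply, inner_proj (hg.pos p) _ _ hZp, inner_proj (hg.pos p) _ _ hZp]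
    have h1 := leviCivita_sub_leviCivita hg (X := W) hW hY
    have h2 : leviCivita g Y p (X p) = leviCivita g Y p (proj (g p) (D p) (X p))
        + leviCivita g Y p (W p) := by
      conv_lhs => rw [← hdec]
      exact covAlong_add (φ := id) (p := p) hg Y _ _
    have h3 : VectorField.mlieBracket 𝓘(ℝ, E)
        (fun q => proj (g q) (orthDist g D q) (X q)) Y p =
        leviCivita g Y p (W p) - leviCivita g W p (Y p) := h1.symm
    rw [h2, h3, map_add, map_sub, add_apply, sub_apply]
    ring
  -- `W` is orthogonal to `D`, so its derivative is determined by those of sections of `D`.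
  have horth : ∀ Y Z : VField E N, DiffAlong (E' := E) id Z p → (∀ᶠ q in 𝓝 p, Z q ∈ D q) →
      g p (leviCivita g W p (Y p)) (Z p) = - g p (W p) (leviCivita g Z p (Y p)) := by
    intro Y Z hZ hZD
    have h1 := (mvfderiv_inner hg (Y := W) hW hZ (Y p)).2
    have h2 : (fun q => g q (W q) (Z q)) =ᶠ[𝓝 p] fun _ => (0 : ℝ) := by
      filter_upwards [hZD] with q hq using hWperp q _ hq
    rw [mvfderiv_congr h2, mvfderiv_const] at h1
    have h3 : (0 : TangentSpace 𝓘(ℝ, E) p →L[ℝ] ℝ) (Y p) = 0 := rfl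
    rw [h3] at h1
    linarith
  rw [(mvfderiv_inner hg hY hZ (X p)).2, hconn Y Z hY hZD.self_of_nhds,
    hg.symm p (Y p) (intrinsicConn g (orthDist g D) X Z p), hconn Z Y hZ hYD.self_of_nhds,
    horth Y Z hZ hZD, horth Z Y hY hYD, hg.symm p (Y p)]
  change _ ↔ g p (W p) (leviCivita g Z p (Y p)) + g p (W p) (leviCivita g Y p (Z p)) = 0
  constructor <;> intro h <;> linarith

theorem inner_secondFF_symm {g : BilinField E N} {ι : M → N} (hι : IsSmoothImmersion E' E ι)
    {p : M} (hg : IsMetricAt g (ι p)) (u v : TangentSpace 𝓘(ℝ, E') p)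
    {n : TangentSpace 𝓘(ℝ, E) (ι p)} (hn : n ∈ normalSpace E' g ι p) :
    g (ι p) n (secondFF g ι p u v) = g (ι p) n (secondFF g ι p v u) := by
  have : IsManifold 𝓘(ℝ, E') 1 M := IsManifold.of_le (n := ∞) (by simp)
  rw [inner_secondFF hg u v hn, inner_secondFF hg v u hn]
  have h := covAlong_sub_covAlong hι.smooth hg (diffAlong_constField u) (diffAlong_constField v)
  rw [constField_self, constField_self, sub_eq_iff_eq_add] at h
  have h0 : g (ι p) n (dmap E' E ι p
      (VectorField.mlieBracket 𝓘(ℝ, E') (constField u) (constField v) p)) = 0 := hn _ ⟨_, rfl⟩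
  rw [h, map_add, h0, zero_add]

theorem inner_secondFF_neg_left {g : BilinField E N} {ι : M → N}
    {p : M} (hg : IsMetricAt g (ι p)) (u v : TangentSpace 𝓘(ℝ, E') p)
    {n : TangentSpace 𝓘(ℝ, E) (ι p)} (hn : n ∈ normalSpace E' g ι p) :
    g (ι p) n (secondFF g ι p (-u) v) = - g (ι p) n (secondFF g ι p u v) := by
  have : IsManifold 𝓘(ℝ, E) 1 N := IsManifold.of_le (n := ∞) (by simp)
  rw [inner_secondFF hg _ v hn, inner_secondFF hg u v hn]
  have h1 := covAlong_add hg (fun q => dmap E' E ι q (constField v q)) u (-u)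
  have h2 := covAlong_add hg (fun q => dmap E' E ι q (constField v q)) (u + -u) (u + -u)
  rw [add_neg_cancel, add_zero] at h2
  have h3 := left_eq_add.1 h2
  rw [add_neg_cancel, h3] at h1
  have h4 := congrArg (g (ι p) n) h1
  rw [map_zero, map_add] at h4
  linarith

/-- If `Z` is a differentiable section of the holomorphic distribution, then so is `J Z`. -/
theorem IsCRSubmanifold.exists_endField {g : BilinField E N} {J : EndField E N} {ι : M → N}
    {D : SubspaceField E' M} (hM : IsCRSubmanifold g J ι D) {p : M} (hg : IsMetricAt g (ι p))
    (hJ : IsAlmostHermitian g J)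
    {Z : VField E' M} (hZ : DiffAlong (E' := E') id Z p) (hZD : ∀ᶠ q in 𝓝 p, Z q ∈ D q) :
    ∃ Z' : VField E' M, DiffAlong (E' := E') id Z' p ∧
      ∀ᶠ q in 𝓝 p, dmap E' E ι q (Z' q) = J (ι q) (dmap E' E ι q (Z q)) := by
  have : IsManifold 𝓘(ℝ, E) 1 N := IsManifold.of_le (n := ∞) (by simp)
  have : IsManifold 𝓘(ℝ, E') 1 M := IsManifold.of_le (n := ∞) (by simp)
  have h1 : ∀ q, ∃ z : TangentSpace 𝓘(ℝ, E') q, Z q ∈ D q →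
      z ∈ D q ∧ dmap E' E ι q z = J (ι q) (dmap E' E ι q (Z q)) := by
    intro q
    by_cases h : Z q ∈ D q
    · obtain ⟨z, h2, h3⟩ := hM.exists_end h
      exact ⟨z, fun _ => ⟨h2, h3⟩⟩
    · exact ⟨0, fun h' => absurd h' h⟩
  choose Z' hZ' using h1
  refine ⟨Z', ?_, by filter_upwards [hZD] with q hq using (hZ' q hq).2⟩
  obtain ⟨r, hr⟩ := hM.distribution
  obtain ⟨U, hU, hpU, X, hX, hspan⟩ := hr p
  have hι := mdifferentiable_of_smooth hM.immersion.smooth p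
  refine diffAlong_of_frame (isMetricAt_inducedMetric hM.immersion p hg)
    (fun i => (hX i).diffAlong hU hpU) (hspan p hpU).1 ?_ fun j => ?_
  · filter_upwards [hU.mem_nhds hpU, hZD] with q hq hq'
    rw [(hspan q hq).2]
    exact (hZ' q hq').1
  · refine (mvfderiv_metric hg hι (diffAlong_end (hJ.mdifferentiableAt_endCoord (ι p)) hι
      (diffAlong_dmap hM.immersion.smooth hZ))
      (diffAlong_dmap hM.immersion.smooth ((hX j).diffAlong hU hpU)) 0).1.congr_of_eventuallyEq ?_
    filter_upwards [hZD] with q hq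
    rw [inducedMetric_apply, (hZ' q hq).2]

/-- The `D^⊥`-component of `∇_u Z`, for a section `Z` of the holomorphic distribution of a
CR-submanifold of a locally conformal Kähler manifold. -/
theorem IsCRSubmanifold.inner_leviCivita {g : BilinField E N} {J : EndField E N}
    {lee : (x : N) → TangentSpace 𝓘(ℝ, E) x →L[ℝ] ℝ} (hN : IsLCK g J lee) {ι : M → N}
    {D : SubspaceField E' M} (hM : IsCRSubmanifold g J ι D) {p : M} (hg : IsMetricAt g (ι p))
    {Z : VField E' M} (hZ : DiffAlong (E' := E') id Z p) (hZD : ∀ᶠ q in 𝓝 p, Z q ∈ D q)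
    {u w jz : TangentSpace 𝓘(ℝ, E') p} (hu : u ∈ D p)
    (hw : w ∈ orthDist (inducedMetric g ι) D p)
    (hjz : dmap E' E ι p jz = J (ι p) (dmap E' E ι p (Z p))) :
    inducedMetric g ι p w (leviCivita (inducedMetric g ι) Z p u) =
      g (ι p) (J (ι p) (dmap E' E ι p w)) (secondFF g ι p u jz)
      - (1 / 2) * (inducedMetric g ι p u (Z p) * lee (ι p) (dmap E' E ι p w))
      + (1 / 2) * (g (ι p) (dmap E' E ι p u) (J (ι p) (dmap E' E ι p (Z p))) *
        g (ι p) (J (ι p) (dmap E' E ι p w)) (leeField g lee (ι p))) := by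
  have hJ := hN.almostHermitian
  have hι := mdifferentiable_of_smooth hM.immersion.smooth p
  have hgM := isMetricAt_inducedMetric hM.immersion p hg
  have hB : ∀ c, g (ι p) (leeField g lee (ι p)) c = lee (ι p) c := fun c =>
    riesz_spec (g (ι p)) (hg.pos _) (lee (ι p)).toLinearMap c
  have hn : J (ι p) (dmap E' E ι p w) ∈ normalSpace E' g ι p :=
    hM.totallyReal p ⟨_, ⟨w, hw, rfl⟩, rfl⟩
  have hn' : ∀ v, g (ι p) (J (ι p) (dmap E' E ι p w)) (dmap E' E ι p v) = 0 := fun v =>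
    hn _ ⟨v, rfl⟩
  obtain ⟨Z', hZ', hJZ⟩ := hM.exists_endField hg hJ hZ hZD
  have hjz' : Z' p = jz := hM.immersion.injective p (hJZ.self_of_nhds.trans hjz.symm)
  have h1 := gauss hM.immersion hg hZ u w
  have h2 := hN.covAlong_end hg hι (diffAlong_dmap hM.immersion.smooth hZ) u
  have h3 : covAlong g ι (fun q => J (ι q) (dmap E' E ι q (Z q))) p u =
      covAlong g ι (fun q => dmap E' E ι q (Z' q)) p u :=
    covAlong_congr g (by filter_upwards [hJZ] with q hq using hq.symm) u
  obtain ⟨v, hv⟩ := covAlong_sub_covAlong_constField g hM.immersion hZ' u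
  rw [h3, hv, hjz'] at h2
  have h4 := inner_secondFF hg u jz hn
  have h5 := congrArg (g (ι p) (J (ι p) (dmap E' E ι p w))) h2
  have h6 : g (ι p) (J (ι p) (dmap E' E ι p w)) (J (ι p) (mfderiv 𝓘(ℝ, E') 𝓘(ℝ, E) ι p u)) = 0 :=
    (hJ.isometric _ _ _).trans (hw u hu)
  have h7 : g (ι p) (J (ι p) (dmap E' E ι p w)) (mfderiv 𝓘(ℝ, E') 𝓘(ℝ, E) ι p u) = 0 := hn' u
  have h8 : g (ι p) (J (ι p) (dmap E' E ι p w)) (J (ι p) (leeField g lee (ι p))) =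
      lee (ι p) (dmap E' E ι p w) := by
    rw [hJ.isometric, hg.symm, hB]
  simp only [map_add, map_sub, map_smul, smul_eq_mul, hn' v, h6, h7, h8, ← h4] at h5
  rw [hJ.isometric] at h5
  rw [hgM.symm, ← h1, hg.symm, h5]
  change _ = _ - (1 / 2) * (g (ι p) (mfderiv 𝓘(ℝ, E') 𝓘(ℝ, E) ι p u) (dmap E' E ι p (Z p)) * _)
    + (1 / 2) * (g (ι p) (mfderiv 𝓘(ℝ, E') 𝓘(ℝ, E) ι p u) (J (ι p) (dmap E' E ι p (Z p))) * _)
  ring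

/-- The metric induced on a CR-submanifold of a locally conformal Kähler manifold is bundle-like for
the totally real foliation if and only if
`g(h(u, Jv) + h(v, Ju), Jw) = g(u, v) ω(w)` for `u, v` in `D` and `w` in `D^⊥`. -/
theorem IsCRSubmanifold.isBundleLike_iff {g : BilinField E N} {J : EndField E N}
    {lee : (x : N) → TangentSpace 𝓘(ℝ, E) x →L[ℝ] ℝ} (hN : IsLCK g J lee) {ι : M → N}
    {D : SubspaceField E' M} (hM : IsCRSubmanifold g J ι D) (hg : ∀ n, IsMetricAt g n) :
    IsBundleLike (inducedMetric g ι) (orthDist (inducedMetric g ι) D) ↔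
      ∀ p, ∀ u ∈ D p, ∀ v ∈ D p, ∀ ju jv w, w ∈ orthDist (inducedMetric g ι) D p →
        dmap E' E ι p ju = J (ι p) (dmap E' E ι p u) →
        dmap E' E ι p jv = J (ι p) (dmap E' E ι p v) →
        g (ι p) (J (ι p) (dmap E' E ι p w)) (secondFF g ι p u jv)
          + g (ι p) (J (ι p) (dmap E' E ι p w)) (secondFF g ι p v ju) =
          inducedMetric g ι p u v * lee (ι p) (dmap E' E ι p w) := by
  have : IsManifold 𝓘(ℝ, E') 1 M := IsManifold.of_le (n := ∞) (by simp)
  have hgM := fun p => isMetricAt_inducedMetric hM.immersion p (hg (ι p))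
  have hDD : ∀ p, orthDist (inducedMetric g ι) (orthDist (inducedMetric g ι) D) p = D p :=
    fun p => perp_perp ((hgM p).pos p) ((hgM p).symm p) (D p)
  -- The pointwise identity between the two second fundamental forms.
  have key : ∀ (p : M) (Y Z : VField E' M) (ju jv w : TangentSpace 𝓘(ℝ, E') p),
      DiffAlong (E' := E') id Y p → DiffAlong (E' := E') id Z p →
      (∀ᶠ q in 𝓝 p, Y q ∈ D q) → (∀ᶠ q in 𝓝 p, Z q ∈ D q) →
      w ∈ orthDist (inducedMetric g ι) D p →
      dmap E' E ι p ju = J (ι p) (dmap E' E ι p (Y p)) →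
      dmap E' E ι p jv = J (ι p) (dmap E' E ι p (Z p)) →
      inducedMetric g ι p w (leviCivita (inducedMetric g ι) Z p (Y p)) +
        inducedMetric g ι p w (leviCivita (inducedMetric g ι) Y p (Z p)) =
        g (ι p) (J (ι p) (dmap E' E ι p w)) (secondFF g ι p (Y p) jv)
          + g (ι p) (J (ι p) (dmap E' E ι p w)) (secondFF g ι p (Z p) ju) -
          inducedMetric g ι p (Y p) (Z p) * lee (ι p) (dmap E' E ι p w) := by
    intro p Y Z ju jv w hY hZ hYD hZD hw hju hjv
    have h1 := hM.inner_leviCivita hN (hg (ι p)) hZ hZD hYD.self_of_nhds hw hjv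
    have h2 := hM.inner_leviCivita hN (hg (ι p)) hY hYD hZD.self_of_nhds hw hju
    have h3 : g (ι p) (dmap E' E ι p (Z p)) (J (ι p) (dmap E' E ι p (Y p))) =
        - g (ι p) (dmap E' E ι p (Y p)) (J (ι p) (dmap E' E ι p (Z p))) := by
      have h4 := hN.almostHermitian.isometric (ι p) (dmap E' E ι p (Y p))
        (J (ι p) (dmap E' E ι p (Z p)))
      rw [hN.almostHermitian.sq, map_neg, (hg (ι p)).symm] at h4
      linarith
    rw [h3] at h2
    rw [h1, h2, (hgM p).symm p (Z p) (Y p)]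
    ring
  constructor
  · intro hBL p u hu v hv ju jv w hw hju hjv
    obtain ⟨U₁, hU₁, hp₁, Y, hY, rfl⟩ := hM.distribution.exists_section hu
    obtain ⟨U₂, hU₂, hp₂, Z, hZ, rfl⟩ := hM.distribution.exists_section hv
    obtain ⟨s, hs, hsm⟩ := FiberBundle.exists_contMDiffOn_extend (k := ∞) 𝓘(ℝ, E') E'
      (V := fun x : M => TangentSpace 𝓘(ℝ, E') x) w
    have hY' := hY.1.diffAlong hU₁ hp₁
    have hZ' := hZ.1.diffAlong hU₂ hp₂
    have hYD : ∀ᶠ q in 𝓝 p, Y q ∈ D q := by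
      filter_upwards [hU₁.mem_nhds hp₁] with q hq using hY.2 q hq
    have hZD : ∀ᶠ q in 𝓝 p, Z q ∈ D q := by
      filter_upwards [hU₂.mem_nhds hp₂] with q hq using hZ.2 q hq
    have h1 := hBL (U₁ ∩ U₂ ∩ interior s) ((hU₁.inter hU₂).inter isOpen_interior)
      (constField w) Y Z (hsm.mono (inter_subset_right.trans interior_subset))
      ⟨hY.1.mono (inter_subset_left.trans inter_subset_left), fun q hq => by
        rw [hDD]; exact hY.2 q hq.1.1⟩
      ⟨hZ.1.mono (inter_subset_left.trans inter_subset_right), fun q hq => by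
        rw [hDD]; exact hZ.2 q hq.1.2⟩ p ⟨⟨hp₁, hp₂⟩, mem_interior_iff_mem_nhds.2 hs⟩
    have hW := diffAlong_proj_orthDist (hgM p) hM.distribution (diffAlong_constField w)
    rw [parallel_iff (hgM p) hY' hZ' hYD hZD hW, constField_self] at h1
    have hwp : proj (inducedMetric g ι p) (orthDist (inducedMetric g ι) D p) w = w := by
      obtain ⟨h2, h3⟩ := proj_spec (inducedMetric g ι p) ((hgM p).pos p)
        (orthDist (inducedMetric g ι) D p) w
      exact (sub_eq_zero.1 (eq_zero_of_mem_perp ((hgM p).pos p)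
        (Submodule.sub_mem _ hw h2) h3)).symm
    rw [hwp, key p Y Z ju jv w hY' hZ' hYD hZD hw hju hjv] at h1
    linarith
  · intro h U hU X Y Z hX hY hZ p hp
    have hYD : ∀ᶠ q in 𝓝 p, Y q ∈ D q := by
      filter_upwards [hU.mem_nhds hp] with q hq
      rw [← hDD]
      exact hY.2 q hq
    have hZD : ∀ᶠ q in 𝓝 p, Z q ∈ D q := by
      filter_upwards [hU.mem_nhds hp] with q hq
      rw [← hDD]
      exact hZ.2 q hq
    have hY' := hY.1.diffAlong hU hp
    have hZ' := hZ.1.diffAlong hU hp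
    have hW := diffAlong_proj_orthDist (hgM p) hM.distribution (hX.diffAlong hU hp)
    rw [parallel_iff (hgM p) hY' hZ' hYD hZD hW]
    obtain ⟨ju, -, hju⟩ := hM.exists_end hYD.self_of_nhds
    obtain ⟨jv, -, hjv⟩ := hM.exists_end hZD.self_of_nhds
    have hw := (proj_spec (inducedMetric g ι p) ((hgM p).pos p)
      (orthDist (inducedMetric g ι) D p) (X p)).1
    rw [key p Y Z ju jv _ hY' hZ' hYD hZD hw hju hjv,
      h p _ hYD.self_of_nhds _ hZD.self_of_nhds ju jv _ hw hju hjv, sub_self]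

end LCK

end

theorem mainTheorem7
    {E : Type*} [NormedAddCommGroup E] [NormedSpace ℝ E] [FiniteDimensional ℝ E]
    {N : Type*} [TopologicalSpace N] [ChartedSpace E N] [IsManifold 𝓘(ℝ, E) ∞ N]
    {E' : Type*} [NormedAddCommGroup E'] [NormedSpace ℝ E'] [FiniteDimensional ℝ E']
    {M : Type*} [TopologicalSpace M] [ChartedSpace E' M] [IsManifold 𝓘(ℝ, E') ∞ M]
    (g : ContMDiffRiemannianMetric 𝓘(ℝ, E) ∞ E (fun x : N => TangentSpace 𝓘(ℝ, E) x))
    (J : LCK.EndField E N) (lee : (x : N) → TangentSpace 𝓘(ℝ, E) x →L[ℝ] ℝ)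
    (hN : LCK.IsLCK g.inner J lee)
    (ι : M → N) (D : LCK.SubspaceField E' M)
    (hM : LCK.IsCRSubmanifold g.inner J ι D) :
    -- (i)
    ((∀ p : M, LCK.leeField g.inner lee (ι p) ∈
          LCK.pushDist E ι D p ⊔ LCK.normalSpace E' g.inner ι p) →
      (LCK.IsBundleLike (LCK.inducedMetric g.inner ι)
          (LCK.orthDist (LCK.inducedMetric g.inner ι) D) ↔
        ∀ (p : M), ∀ u ∈ D p, ∀ v ∈ D p, ∀ ju ∈ D p, ∀ jv ∈ D p,
          LCK.dmap E' E ι p ju = J (ι p) (LCK.dmap E' E ι p u) →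
          LCK.dmap E' E ι p jv = J (ι p) (LCK.dmap E' E ι p v) →
          LCK.secondFF g.inner ι p u jv + LCK.secondFF g.inner ι p v ju ∈
            LCK.muSpace g.inner J ι D p)) ∧
    -- (ii)
    ((∃ p : M, D p ≠ ⊥) →
      (∃ p : M, LCK.proj (g.inner (ι p))
          (LCK.pushDist E ι (LCK.orthDist (LCK.inducedMetric g.inner ι) D) p)
          (LCK.leeField g.inner lee (ι p)) ≠ 0) →
      ¬ LCK.IsBundleLike (LCK.inducedMetric g.inner ι)
          (LCK.orthDist (LCK.inducedMetric g.inner ι) D)) := by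
  have hg := LCK.isMetricAt_riemannian g
  have hgM := fun p => LCK.isMetricAt_inducedMetric hM.immersion p (hg (ι p))
  have hB : ∀ n c, g.inner n (LCK.leeField g.inner lee n) c = lee n c := fun n c =>
    LCK.riesz_spec (g.inner n) ((hg n).pos n) (lee n).toLinearMap c
  have hnormal : ∀ p, ∀ w ∈ LCK.orthDist (LCK.inducedMetric g.inner ι) D p,
      J (ι p) (LCK.dmap E' E ι p w) ∈ LCK.normalSpace E' g.inner ι p := fun p w hw =>
    hM.totallyReal p ⟨_, ⟨w, hw, rfl⟩, rfl⟩
  rw [hM.isBundleLike_iff hN hg]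
  refine ⟨fun hLee => ?_, ?_⟩
  · have hlee0 : ∀ p, ∀ w ∈ LCK.orthDist (LCK.inducedMetric g.inner ι) D p,
        lee (ι p) (LCK.dmap E' E ι p w) = 0 := by
      intro p w hw
      obtain ⟨a, ⟨d, hd, rfl⟩, b, hb, hab⟩ := Submodule.mem_sup.1 (hLee p)
      have h1 : g.inner (ι p) (LCK.dmap E' E ι p d) (LCK.dmap E' E ι p w) = 0 := by
        rw [(hg (ι p)).symm]
        exact hw d hd
      have h2 : g.inner (ι p) b (LCK.dmap E' E ι p w) = 0 := hb _ ⟨w, rfl⟩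
      rw [← hB, ← hab, map_add, add_apply, h2, add_zero]
      exact h1
    constructor
    · intro h p u hu v hv ju _ jv _ hju hjv
      refine ⟨Submodule.add_mem _ (LCK.proj_spec _ ((hg (ι p)).pos _) _ _).1
        (LCK.proj_spec _ ((hg (ι p)).pos _) _ _).1, ?_⟩
      rintro _ ⟨_, ⟨w, hw, rfl⟩, rfl⟩
      have h1 := h p u hu v hv ju jv w hw hju hjv
      rw [hlee0 p w hw, mul_zero, ← map_add, (hg (ι p)).symm] at h1
      exact h1
    · intro h p u hu v hv ju jv w hw hju hjv
      obtain ⟨ju', hju1, hju2⟩ := hM.exists_end hu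
      obtain ⟨jv', hjv1, hjv2⟩ := hM.exists_end hv
      have e1 : ju = ju' := hM.immersion.injective p (hju.trans hju2.symm)
      have e2 : jv = jv' := hM.immersion.injective p (hjv.trans hjv2.symm)
      subst e1 e2
      rw [hlee0 p w hw, mul_zero, ← map_add, (hg (ι p)).symm]
      exact (h p u hu v hv ju hju1 jv hjv1 hju hjv).2 _ ⟨_, ⟨w, hw, rfl⟩, rfl⟩
  · rintro ⟨p₀, hp₀⟩ ⟨p, hp⟩ h
    apply hp
    obtain ⟨u, hu, hu0⟩ := Submodule.exists_mem_ne_zero_of_ne_bot (hM.distribution.ne_bot hp₀ p)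
    obtain ⟨ju, hju, hJu⟩ := hM.exists_end hu
    have hJJu : LCK.dmap E' E ι p (-u) = J (ι p) (LCK.dmap E' E ι p ju) := by
      rw [hJu, hN.almostHermitian.sq, map_neg]
    -- Comparing the condition for `(u, u)` and for `(Ju, Ju)` shows that `ω` vanishes on `D^⊥`.
    have hlee0 : ∀ w ∈ LCK.orthDist (LCK.inducedMetric g.inner ι) D p,
        lee (ι p) (LCK.dmap E' E ι p w) = 0 := by
      intro w hw
      have hn := hnormal p w hw
      have h1 := h p u hu u hu ju ju w hw hJu hJu
      have h2 := h p ju hju ju hju (-u) (-u) w hw hJJu hJJu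
      have h3 := LCK.inner_secondFF_symm hM.immersion (hg (ι p)) ju (-u) hn
      rw [LCK.inner_secondFF_neg_left (hg (ι p)) u ju hn] at h3
      rw [h3] at h2
      have h4 := (hgM p).pos p u hu0
      have h5 : 0 ≤ LCK.inducedMetric g.inner ι p ju ju := by
        by_cases h0 : ju = 0
        · rw [h0, map_zero]
        · exact ((hgM p).pos p ju h0).le
      have h6 : (LCK.inducedMetric g.inner ι p u u + LCK.inducedMetric g.inner ι p ju ju) *
          lee (ι p) (LCK.dmap E' E ι p w) = 0 := by linarith
      exact (mul_eq_zero.1 h6).resolve_left (by linarith)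
    obtain ⟨h1, h2⟩ := LCK.proj_spec (g.inner (ι p)) ((hg (ι p)).pos _)
      (LCK.pushDist E ι (LCK.orthDist (LCK.inducedMetric g.inner ι) D) p)
      (LCK.leeField g.inner lee (ι p))
    have h3 : LCK.leeField g.inner lee (ι p) ∈ LCK.perp (g.inner (ι p))
        (LCK.pushDist E ι (LCK.orthDist (LCK.inducedMetric g.inner ι) D) p) := by
      rintro _ ⟨w, hw, rfl⟩
      rw [hB]
      exact hlee0 w hw
    have h4 := Submodule.sub_mem _ h3 h2
    rw [sub_sub_cancel] at h4
    exact LCK.eq_zero_of_mem_perp ((hg (ι p)).pos _) h1 h4
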